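/- Let $d\ge 2$. Write $x\sim y$ for nearest neighbours in $\mathbb Z^d$, and let $\Lambda_N=\{0,\dots,N\}^d$, $\tilde\Lambda_N=\{1,\dots,N\}^d$, $\partial\Lambda_N=\{x\in\Lambda_N:\exists y\notin\Lambda_N,\ y\sim x\}$ and $\mathring\Lambda_N=\Lambda_N\setminus\partial\Lambda_N$. Let $\mathbf P_N$ be the lattice Gaussian free field on $\Lambda_N$ with zero boundary condition: $\phi_x=0$ for $x\in\partial\Lambda_N$, and $(\phi_x)_{x\in\mathring\Lambda_N}$ has density with respect to Lebesgue measure on $\mathbb R^{\mathring\Lambda_N}$ proportional to $$\exp\Big(-\frac12\sum_{(x,y)\in\Lambda_N^2\setminus(\partial\Lambda_N)^2,\ x\sim y}\frac{(\phi_x-\phi_y)^2}{2}\Big).$$ Let $\omega=(\omega_x)_{x\in\mathbb Z^d}$ be i.i.d. square integrable centered real random variables with positive variance, with law $\mathbb P$ and expectation $\mathbb E$, put $\lambda(b)=\log\mathbb E[e^{b\omega_0}]$, and assume that there is $\overline\beta\in(0,\infty]$ with $\max(\lambda(2b),\lambda(-b))<\infty$ for every $b\in(0,\overline\beta)$. Fix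 $\beta\in(0,\overline\beta)$, and for $h\in\mathbb R$ let $\mathbf P^{\beta,\omega}_{N,h}$ be the probability measure whose density with respect to $\mathbf P_N$ is proportional to $$\exp\Big(\sum_{x\in\tilde\Lambda_N}(\beta\omega_x-\lambda(\beta)+h)\,\mathbf 1_{[-1,1]}(\phi_x)\Big).$$ Then for every $\varepsilon>0$ there is $h_0>0$ (depending on $\varepsilon$, and on $d$, $\beta$ and the law of $\omega_0$, which are fixed) such that for all $h\in(0,h_0)$ $$\lim_{N\to\infty}\mathbb E\Big[\mathbf P^{\beta,\omega}_{N,h}\Big(\sum_{x\in\tilde\Lambda_N}\mathbf 1_{\{|\phi_x|\le\sqrt{\frac1{4d}\log(1/h)}\}}\ge\varepsilon N^d\Big)\Big]=0 .$$ -/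

import Mathlib

open MeasureTheory ProbabilityTheory Filter Topology

noncomputable section

namespace PinnedField

/-- The sites of the lattice `ℤ^d`. -/
abbrev Site (d : ℕ) := Fin d → ℤ

/-- Nearest neighbours in `ℤ^d`: the `ℓ¹` distance is one. -/
def Adj {d : ℕ} (x y : Site d) : Prop := ∑ i, |x i - y i| = 1

open Classical in
/-- The internal boundary `∂Λ`: the points of `Λ` having a neighbour outside `Λ`. -/
def innerBoundary {d : ℕ} (Λ : Finset (Site d)) : Finset (Site d) :=
  Λ.filter fun x => ∃ y, y ∉ Λ ∧ Adj x y

/-- The interior points `Λ \ ∂Λ`. -/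
def interiorPts {d : ℕ} (Λ : Finset (Site d)) : Finset (Site d) := Λ \ innerBoundary Λ

/-- The box `Λ_N = {0, …, N}^d`. -/
def box (d N : ℕ) : Finset (Site d) := Fintype.piFinset fun _ => Finset.Icc (0 : ℤ) N

/-- The box `{1, …, N}^d`. -/
def tildeBox (d N : ℕ) : Finset (Site d) := Fintype.piFinset fun _ => Finset.Icc (1 : ℤ) N

/-- The field that equals `φ` at the interior points of `Λ` and the boundary condition `bc`
everywhere else. -/
def glue {d : ℕ} (Λ : Finset (Site d)) (bc : Site d → ℝ) (φ : interiorPts Λ → ℝ) : Site d → ℝ :=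
  fun x => if hx : x ∈ interiorPts Λ then φ ⟨x, hx⟩ else bc x

open Classical in
/-- The Hamiltonian `½ ∑ (φ_x - φ_y)² / 2`, the sum over ordered pairs of neighbours
`(x, y) ∈ Λ² \ (∂Λ)²`. -/
def energy {d : ℕ} (Λ : Finset (Site d)) (φ : Site d → ℝ) : ℝ :=
  (1 / 2) * ∑ p ∈ ((Λ ×ˢ Λ) \ (innerBoundary Λ ×ˢ innerBoundary Λ)).filter (fun p => Adj p.1 p.2),
    (φ p.1 - φ p.2) ^ 2 / 2

/-- The lattice Gaussian free field on `Λ` with boundary condition `bc`: the probability measure on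
`ℝ^(interiorPts Λ)` whose density with respect to Lebesgue measure is proportional to `exp (-energy)`. -/
def freeField {d : ℕ} (Λ : Finset (Site d)) (bc : Site d → ℝ) : Measure (interiorPts Λ → ℝ) :=
  (volume : Measure (interiorPts Λ → ℝ)).tilted fun φ => -energy Λ (glue Λ bc φ)

/-- The contact indicator `δ = 1_{[-1,1]}`. -/
def contact (t : ℝ) : ℝ := Set.indicator (Set.Icc (-1) 1) (fun _ => 1) t

/-- The quenched pinning measure on the box `Λ_N` in the environment `w`: its density with respect
to the free field is proportional to `exp (∑_x (β w_x - lam + h) δ_x)`, the sum over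
`{1, …, N}^d`. -/
def pinned (d N : ℕ) (bc : Site d → ℝ) (β lam h : ℝ) (w : Site d → ℝ) :
    Measure (interiorPts (box d N) → ℝ) :=
  (freeField (box d N) bc).tilted fun φ =>
    ∑ x ∈ tildeBox d N, (β * w x - lam + h) * contact (glue (box d N) bc φ x)

open Classical in
/-- The number of sites `x` of `{1, …, N}^d` with `|φ_x| ≤ r`. -/
def lowCount (d N : ℕ) (r : ℝ) (φ : Site d → ℝ) : ℕ :=
  ((tildeBox d N).filter fun x => |φ x| ≤ r).card

end PinnedField

end

/-! The contacts with `[-1,1]` are counted, with threshold `m` of order `h N^d`: having at least `m`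
contacts is ruled out by the disorder, and having fewer is incompatible with many low sites.

The partition function is at least the free probability of having no contact, and this costs only
`exp(-ρ N^d)` for any `ρ > 0` (`eventually_le_gaussMeasure_one_lt`). Indeed the variance of `φ_x`
grows at most linearly in the distance to the boundary, so a shift by the square root of that
distance, with a logarithmic factor, lifts the whole field above `1`; its Dirichlet energy is of
order `N^(d-1) (log N)^2`.

For many contacts, `tilted_apply_le` trades the bound on their number for the square root of the
partition function at pinning `2h`. Non-degenerate disorder makes the mean of this square root at
most `exp(4 C h^2 N^d)`: each site gains only quadratically in `h` (`exists_integral_sqrt_le`), and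
the sites are integrated out in turn (`lintegral_rpow_siteWeight_le`). Against this stands a factor
`exp(-h m / 2)`, which wins once `m / (h N^d)` is a large enough constant.

For few contacts, the annealed bound `lintegral_lintegral_siteWeight_le` costs only `exp(h m)`, and
what remains is a free field estimate. Given its neighbours, `φ_x` is Gaussian with variance
`1/(2d)`. If its conditional mean is near the height `√(log(1/h)/(4d))` or below it, a contact has
conditional probability about `h^(1/4)`, up to lower order corrections, and certainly a constant
times `h^(1/3)`. A positive density of low sites therefore forces contacts of density `h^(1/3)`,
much larger than `h`. The exponential form is `exists_lowWeight_bound`, propagated through the box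
by `lintegral_gaussMeasure_prod_le`. -/

open MeasureTheory ProbabilityTheory Filter Topology

noncomputable section

namespace PinnedField

/-! ### Nearest neighbours and the box -/

section Lattice

variable {d : ℕ}

/-- The nearest neighbours of a site. -/
def nbrs (x : Site d) : Finset (Site d) :=
  (Finset.univ ×ˢ ({1, -1} : Finset ℤ)).image fun q : Fin d × ℤ => x + Pi.single q.1 q.2

theorem mem_nbrs {x y : Site d} :
    y ∈ nbrs x ↔ ∃ i : Fin d, y = x + Pi.single i 1 ∨ y = x + Pi.single i (-1) := by
  simp only [nbrs, Finset.mem_image, Finset.mem_product, Finset.mem_univ, true_and,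
    Finset.mem_insert, Finset.mem_singleton, Prod.exists]
  constructor
  · rintro ⟨i, s, rfl | rfl, rfl⟩
    · exact ⟨i, Or.inl rfl⟩
    · exact ⟨i, Or.inr rfl⟩
  · rintro ⟨i, rfl | rfl⟩
    · exact ⟨i, 1, Or.inl rfl, rfl⟩
    · exact ⟨i, -1, Or.inr rfl, rfl⟩

theorem card_nbrs (x : Site d) : (nbrs x).card = 2 * d := by
  rw [nbrs, Finset.card_image_of_injOn]
  · simp [mul_comm]
  · rintro ⟨i, s⟩ hi ⟨j, t⟩ hj h
    simp only [Finset.coe_product, Set.mem_prod, Finset.coe_univ, Set.mem_univ, true_and,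
      Finset.coe_insert, Finset.coe_singleton, Set.mem_insert_iff, Set.mem_singleton_iff] at hi hj
    have h' : (Pi.single i s : Site d) = Pi.single j t := add_left_cancel h
    have hs : s ≠ 0 := by rcases hi with rfl | rfl <;> norm_num
    have hij : i = j := by
      by_contra hne
      have := congrFun h' i
      rw [Pi.single_eq_same, Pi.single_eq_of_ne hne] at this
      exact hs this
    subst hij
    have := congrFun h' i
    simp only [Pi.single_eq_same] at this
    rw [this]

theorem adj_comm {x y : Site d} : Adj x y ↔ Adj y x := by
  simp only [Adj, abs_sub_comm]

theorem adj_iff_mem_nbrs {x y : Site d} : Adj x y ↔ y ∈ nbrs x := by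
  rw [mem_nbrs, Adj]
  constructor
  · intro h
    obtain ⟨i, hi⟩ : ∃ i, x i ≠ y i := by
      by_contra! hc
      simp [hc] at h
    have hsum := Finset.add_sum_erase Finset.univ (fun i => |x i - y i|) (Finset.mem_univ i)
    have h1 : 1 ≤ |x i - y i| := Int.one_le_abs (sub_ne_zero.2 hi)
    have hnn : ∀ j ∈ Finset.univ.erase i, 0 ≤ |x j - y j| := fun j _ => abs_nonneg _
    have h0 : ∑ j ∈ Finset.univ.erase i, |x j - y j| = 0 := by
      have := Finset.sum_nonneg hnn
      omega
    have hx1 : |x i - y i| = 1 := by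
      omega
    have hz := (Finset.sum_eq_zero_iff_of_nonneg hnn).1 h0
    have hrest : ∀ j, j ≠ i → y j = x j := fun j hj => by
      have := abs_eq_zero.1 (hz j (Finset.mem_erase.2 ⟨hj, Finset.mem_univ j⟩))
      omega
    refine ⟨i, ?_⟩
    rcases (abs_eq zero_le_one).1 hx1 with h2 | h2
    · right
      ext j
      by_cases hj : j = i
      · subst hj; simp; omega
      · simp [hj, hrest j hj]
    · left
      ext j
      by_cases hj : j = i
      · subst hj; simp; omega
      · simp [hj, hrest j hj]
  · rintro ⟨i, rfl | rfl⟩ <;>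
    · rw [Finset.sum_eq_single i]
      · simp
      · intro j _ hj
        simp [hj]
      · simp

theorem adj_add_single (x : Site d) (i : Fin d) {s : ℤ} (hs : s = 1 ∨ s = -1) :
    Adj x (x + Pi.single i s) := by
  rw [adj_iff_mem_nbrs, mem_nbrs]
  rcases hs with rfl | rfl
  · exact ⟨i, Or.inl rfl⟩
  · exact ⟨i, Or.inr rfl⟩

theorem Adj.abs_sub_le {x y : Site d} (h : Adj x y) (i : Fin d) : |x i - y i| ≤ 1 := by
  rw [← h]
  exact Finset.single_le_sum (f := fun i => |x i - y i|) (fun j _ => abs_nonneg _)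
    (Finset.mem_univ i)

theorem Adj.ne {x y : Site d} (h : Adj x y) : x ≠ y := by
  rintro rfl
  simp [Adj] at h

theorem mem_interiorPts {Λ : Finset (Site d)} {x : Site d} :
    x ∈ interiorPts Λ ↔ x ∈ Λ ∧ ∀ y, Adj x y → y ∈ Λ := by
  simp only [interiorPts, innerBoundary, Finset.mem_sdiff, Finset.mem_filter, not_and, not_exists]
  constructor
  · rintro ⟨hx, h⟩
    refine ⟨hx, fun y hy => ?_⟩
    by_contra hc
    exact h hx y hc hy
  · rintro ⟨hx, h⟩
    exact ⟨hx, fun _ y hc hy => hc (h y hy)⟩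

theorem mem_box {N : ℕ} {x : Site d} : x ∈ box d N ↔ ∀ i, 0 ≤ x i ∧ x i ≤ N := by
  simp [box, Fintype.mem_piFinset]

theorem mem_tildeBox {N : ℕ} {x : Site d} : x ∈ tildeBox d N ↔ ∀ i, 1 ≤ x i ∧ x i ≤ N := by
  simp [tildeBox, Fintype.mem_piFinset]

theorem mem_interiorPts_box {N : ℕ} {x : Site d} :
    x ∈ interiorPts (box d N) ↔ ∀ i, 1 ≤ x i ∧ x i + 1 ≤ N := by
  rw [mem_interiorPts]
  constructor
  · rintro ⟨_, h⟩ i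
    have h1 := mem_box.1 (h _ (adj_add_single x i (Or.inl rfl))) i
    have h2 := mem_box.1 (h _ (adj_add_single x i (Or.inr rfl))) i
    simp at h1 h2
    omega
  · intro h
    refine ⟨mem_box.2 fun i => by have := h i; omega, fun y hy => mem_box.2 fun i => ?_⟩
    have h1 := h i
    have h2 := abs_le.1 (hy.abs_sub_le i)
    omega

theorem interiorPts_subset_tildeBox (N : ℕ) : interiorPts (box d N) ⊆ tildeBox d N := fun x hx =>
  mem_tildeBox.2 fun i => by have := mem_interiorPts_box.1 hx i; omega

theorem card_tildeBox (N : ℕ) : (tildeBox d N).card = N ^ d := by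
  simp [tildeBox, Fintype.card_piFinset]

theorem interiorPts_box_eq (N : ℕ) :
    interiorPts (box d N) = Fintype.piFinset fun _ => Finset.Icc (1 : ℤ) (N - 1) := by
  ext x
  simp only [mem_interiorPts_box, Fintype.mem_piFinset, Finset.mem_Icc]
  refine forall_congr' fun i => ?_
  omega

theorem card_interiorPts_box {N : ℕ} : (interiorPts (box d N)).card = (N - 1) ^ d := by
  rw [interiorPts_box_eq]
  simp [Fintype.card_piFinset]

end Lattice

/-! ### The energy as a quadratic form -/

section Energy

variable {d : ℕ} (Λ : Finset (Site d))

theorem glue_of_mem (bc : Site d → ℝ) (φ : interiorPts Λ → ℝ) (x : interiorPts Λ) :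
    glue Λ bc φ x = φ x := by
  simp [glue]

theorem glue_of_notMem (bc : Site d → ℝ) (φ : interiorPts Λ → ℝ) {x : Site d}
    (hx : x ∉ interiorPts Λ) : glue Λ bc φ x = bc x := by
  simp [glue, hx]

theorem glue_zero_add (φ ψ : interiorPts Λ → ℝ) (x : Site d) :
    glue Λ (fun _ => 0) (φ + ψ) x = glue Λ (fun _ => 0) φ x + glue Λ (fun _ => 0) ψ x := by
  unfold glue; split_ifs <;> simp

theorem glue_zero_smul (c : ℝ) (φ : interiorPts Λ → ℝ) (x : Site d) :
    glue Λ (fun _ => 0) (c • φ) x = c * glue Λ (fun _ => 0) φ x := by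
  unfold glue; split_ifs <;> simp

theorem continuous_glue (bc : Site d → ℝ) (x : Site d) :
    Continuous fun φ : interiorPts Λ → ℝ => glue Λ bc φ x := by
  unfold glue
  split_ifs <;> fun_prop

open Classical in
/-- The ordered pairs of neighbours in `Λ`, not both on the boundary. -/
def bonds : Finset (Site d × Site d) :=
  ((Λ ×ˢ Λ) \ (innerBoundary Λ ×ˢ innerBoundary Λ)).filter (fun p => Adj p.1 p.2)

theorem mem_bonds {p : Site d × Site d} :
    p ∈ bonds Λ ↔ p.1 ∈ Λ ∧ p.2 ∈ Λ ∧ (p.1 ∈ interiorPts Λ ∨ p.2 ∈ interiorPts Λ) ∧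
      Adj p.1 p.2 := by
  simp only [bonds, interiorPts, Finset.mem_filter, Finset.mem_sdiff, Finset.mem_product]
  tauto

theorem energy_eq (φ : Site d → ℝ) :
    energy Λ φ = (1 / 4) * ∑ p ∈ bonds Λ, (φ p.1 - φ p.2) ^ 2 := by
  rw [energy, bonds, ← Finset.sum_div]
  ring

/-- The Dirichlet form of the free field with zero boundary condition. -/
def dirichlet : LinearMap.BilinForm ℝ (interiorPts Λ → ℝ) :=
  LinearMap.mk₂ ℝ
    (fun φ ψ => (1 / 2) * ∑ p ∈ bonds Λ,
      (glue Λ (fun _ => 0) φ p.1 - glue Λ (fun _ => 0) φ p.2) *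
        (glue Λ (fun _ => 0) ψ p.1 - glue Λ (fun _ => 0) ψ p.2))
    (fun φ φ' ψ => by
      rw [← mul_add, ← Finset.sum_add_distrib]
      congr 1
      refine Finset.sum_congr rfl fun p _ => ?_
      simp only [glue_zero_add]; ring)
    (fun c φ ψ => by
      rw [smul_eq_mul, mul_left_comm, Finset.mul_sum (a := c)]
      congr 1
      refine Finset.sum_congr rfl fun p _ => ?_
      simp only [glue_zero_smul]; ring)
    (fun φ ψ ψ' => by
      rw [← mul_add, ← Finset.sum_add_distrib]
      congr 1
      refine Finset.sum_congr rfl fun p _ => ?_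
      simp only [glue_zero_add]; ring)
    (fun c φ ψ => by
      rw [smul_eq_mul, mul_left_comm, Finset.mul_sum (a := c)]
      congr 1
      refine Finset.sum_congr rfl fun p _ => ?_
      simp only [glue_zero_smul]; ring)

theorem dirichlet_apply (φ ψ : interiorPts Λ → ℝ) :
    dirichlet Λ φ ψ = (1 / 2) * ∑ p ∈ bonds Λ,
      (glue Λ (fun _ => 0) φ p.1 - glue Λ (fun _ => 0) φ p.2) *
        (glue Λ (fun _ => 0) ψ p.1 - glue Λ (fun _ => 0) ψ p.2) := rfl

theorem dirichlet_comm (φ ψ : interiorPts Λ → ℝ) : dirichlet Λ φ ψ = dirichlet Λ ψ φ := by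
  simp only [dirichlet_apply, mul_comm]

theorem continuous_dirichlet_self : Continuous fun φ => dirichlet Λ φ φ := by
  simp only [dirichlet_apply]
  have := continuous_glue Λ (fun _ => 0)
  fun_prop

theorem energy_glue (φ : interiorPts Λ → ℝ) :
    energy Λ (glue Λ (fun _ => 0) φ) = dirichlet Λ φ φ / 2 := by
  simp only [energy_eq, dirichlet_apply, ← sq]
  ring

theorem glue_single (x : interiorPts Λ) (y : Site d) :
    glue Λ (fun _ => 0) (Pi.single x 1) y = if y = x then 1 else 0 := by
  unfold glue
  split_ifs with h1 h2 h2
  · subst h2; simp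
  · rw [Pi.single_eq_of_ne]
    intro h
    exact h2 (by rw [← h])
  · subst h2; exact absurd x.2 h1
  · rfl

/-- All neighbours of an interior point lie in `Λ`, so `4d` ordered bonds touch it, each counted
with weight one half. This fixes the conditional variance `1/(2d)` of one coordinate, the source of
the constant `4d` in the height of the theorem. -/
theorem dirichlet_single (x : interiorPts Λ) :
    dirichlet Λ (Pi.single x 1) (Pi.single x 1) = 2 * d := by
  have hx := mem_interiorPts.1 x.2
  rw [dirichlet_apply]
  simp only [glue_single]
  have key : (bonds Λ).filter (fun p => p.1 = (x : Site d) ∨ p.2 = (x : Site d)) =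
      ((nbrs (x : Site d)).image fun y => ((x : Site d), y)) ∪
        ((nbrs (x : Site d)).image fun y => (y, (x : Site d))) := by
    ext ⟨a, b⟩
    simp only [Finset.mem_filter, mem_bonds, Finset.mem_union, Finset.mem_image, Prod.mk.injEq,
      ← adj_iff_mem_nbrs]
    constructor
    · rintro ⟨⟨_, _, _, hab⟩, h | h⟩
      · exact Or.inl ⟨b, h ▸ hab, h.symm, rfl⟩
      · exact Or.inr ⟨a, h ▸ adj_comm.1 hab, rfl, h.symm⟩
    · rintro (⟨c, hc, rfl, rfl⟩ | ⟨c, hc, rfl, rfl⟩)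
      · exact ⟨⟨hx.1, hx.2 _ hc, Or.inl x.2, hc⟩, Or.inl rfl⟩
      · exact ⟨⟨hx.2 _ hc, hx.1, Or.inr x.2, adj_comm.1 hc⟩, Or.inr rfl⟩
  have hval : ∀ p ∈ bonds Λ,
      ((if p.1 = (x : Site d) then (1 : ℝ) else 0) - if p.2 = (x : Site d) then 1 else 0) *
        ((if p.1 = (x : Site d) then (1 : ℝ) else 0) - if p.2 = (x : Site d) then 1 else 0) =
      if p.1 = (x : Site d) ∨ p.2 = (x : Site d) then 1 else 0 := by
    intro p hp
    have hne := ((mem_bonds Λ).1 hp).2.2.2.ne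
    by_cases h1 : p.1 = (x : Site d) <;> by_cases h2 : p.2 = (x : Site d)
    · exact absurd (h1.trans h2.symm) hne
    all_goals simp [h1, h2]
  rw [Finset.sum_congr rfl hval, ← Finset.sum_filter, key]
  rw [Finset.sum_const, Finset.card_union_of_disjoint, Finset.card_image_of_injective,
    Finset.card_image_of_injective, card_nbrs]
  · simp; ring
  · intro a b h; exact congrArg Prod.fst h
  · intro a b h; exact congrArg Prod.snd h
  · rw [Finset.disjoint_left]
    rintro ⟨a, b⟩ h1 h2
    simp only [Finset.mem_image, Prod.mk.injEq, ← adj_iff_mem_nbrs] at h1 h2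
    obtain ⟨c, hc, rfl, rfl⟩ := h1
    obtain ⟨e, he, rfl, h⟩ := h2
    exact he.ne rfl

/-- If `k` steps from `x` in a coordinate direction leave the interior, the value of the field at
`x` is controlled by the energy. -/
theorem sq_le_dirichlet_of_path (φ : interiorPts Λ → ℝ) (x : Site d) (i : Fin d) {s : ℤ}
    (hs : s = 1 ∨ s = -1) (k : ℕ)
    (hin : ∀ j : ℕ, j < k → x + Pi.single i (s * j) ∈ interiorPts Λ)
    (hout : x + Pi.single i (s * k) ∉ interiorPts Λ) :
    glue Λ (fun _ => 0) φ x ^ 2 ≤ 2 * k * dirichlet Λ φ φ := by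
  set g := glue Λ (fun _ => 0) φ
  set γ : ℕ → Site d := fun j => x + Pi.single i (s * j)
  have hs0 : s ≠ 0 := by rcases hs with rfl | rfl <;> norm_num
  have hsum : g x = ∑ j ∈ Finset.range k, (g (γ j) - g (γ (j + 1))) := by
    rw [Finset.sum_range_sub']
    have h0 : γ 0 = x := by simp [γ]
    have hk : g (γ k) = 0 := glue_of_notMem Λ _ φ hout
    rw [h0, hk, sub_zero]
  have hinj : Set.InjOn (fun j => (γ j, γ (j + 1))) (Finset.range k) := by
    intro a _ b _ h
    have h1 : γ a = γ b := congrArg Prod.fst h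
    have h2 := congrFun h1 i
    simp only [γ, Pi.add_apply, Pi.single_eq_same, add_right_inj] at h2
    exact_mod_cast mul_left_cancel₀ hs0 h2
  have hsub : (Finset.range k).image (fun j => (γ j, γ (j + 1))) ⊆ bonds Λ := by
    intro p hp
    obtain ⟨j, hj, rfl⟩ := Finset.mem_image.1 hp
    have hj' := hin j (Finset.mem_range.1 hj)
    have hadj : Adj (γ j) (γ (j + 1)) := by
      have : γ (j + 1) = γ j + Pi.single i s := by
        simp only [γ, add_assoc, ← Pi.single_add]
        congr 2
        push_cast; ring
      rw [this]
      exact adj_add_single _ i hs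
    have := mem_interiorPts.1 hj'
    exact (mem_bonds Λ).2 ⟨this.1, this.2 _ hadj, Or.inl hj', hadj⟩
  have hle : ∑ j ∈ Finset.range k, (g (γ j) - g (γ (j + 1))) ^ 2 ≤ 2 * dirichlet Λ φ φ := by
    rw [← Finset.sum_image (f := fun p : Site d × Site d => (g p.1 - g p.2) ^ 2) hinj]
    refine (Finset.sum_le_sum_of_subset_of_nonneg hsub fun _ _ _ => sq_nonneg _).trans ?_
    rw [dirichlet_apply]
    apply le_of_eq
    rw [← mul_assoc]
    norm_num
    exact Finset.sum_congr rfl fun p _ => by rw [sq]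
  rw [hsum]
  calc (∑ j ∈ Finset.range k, (g (γ j) - g (γ (j + 1)))) ^ 2
      ≤ (Finset.range k).card * ∑ j ∈ Finset.range k, (g (γ j) - g (γ (j + 1))) ^ 2 :=
        sq_sum_le_card_mul_sum_sq
    _ ≤ k * (2 * dirichlet Λ φ φ) := by
        rw [Finset.card_range]
        gcongr
    _ = _ := by ring

end Energy

/-! ### Distance to the boundary of the box -/

section Distance

variable {d : ℕ} [NeZero d]

/-- The distance of a site to the boundary of the box `{0, …, N}^d`. -/
def bdist (N : ℕ) (x : Site d) : ℤ :=
  Finset.univ.inf' Finset.univ_nonempty fun i => min (x i) (N - x i)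

theorem bdist_le (N : ℕ) (x : Site d) (i : Fin d) : bdist N x ≤ min (x i) (N - x i) :=
  Finset.inf'_le _ (Finset.mem_univ i)

theorem exists_bdist_eq (N : ℕ) (x : Site d) : ∃ i, bdist N x = min (x i) (N - x i) := by
  obtain ⟨i, _, hi⟩ := Finset.exists_mem_eq_inf' (Finset.univ_nonempty (α := Fin d))
    fun i => min (x i) (N - x i)
  exact ⟨i, hi⟩

theorem bdist_pos {N : ℕ} {x : Site d} (hx : x ∈ interiorPts (box d N)) : 1 ≤ bdist N x := by
  obtain ⟨i, hi⟩ := exists_bdist_eq N x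
  have := mem_interiorPts_box.1 hx i
  omega

theorem bdist_nonneg {N : ℕ} {x : Site d} (hx : x ∈ box d N) : 0 ≤ bdist N x := by
  obtain ⟨i, hi⟩ := exists_bdist_eq N x
  have := mem_box.1 hx i
  omega

theorem bdist_eq_zero {N : ℕ} {x : Site d} (hx : x ∈ box d N) (hx' : x ∉ interiorPts (box d N)) :
    bdist N x = 0 := by
  refine le_antisymm ?_ (bdist_nonneg hx)
  rw [mem_interiorPts_box] at hx'
  push Not at hx'
  obtain ⟨i, hi⟩ := hx'
  have h1 := bdist_le N x i
  have h2 := mem_box.1 hx i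
  by_cases h3 : 1 ≤ x i
  · have := hi h3
    omega
  · omega

theorem Adj.bdist_le {N : ℕ} {x y : Site d} (h : Adj x y) : bdist N x ≤ bdist N y + 1 := by
  obtain ⟨i, hi⟩ := exists_bdist_eq N y
  have h1 := PinnedField.bdist_le N x i
  have h2 := abs_le.1 (h.abs_sub_le i)
  omega

/-- Walk straight to the nearest face and apply Cauchy–Schwarz to the increments. The resulting
variance proxy `bdist` is crude but suffices, since only a sub-volume cost is needed. -/
theorem sq_le_bdist_mul_dirichlet (N : ℕ) (φ : interiorPts (box d N) → ℝ)
    (x : interiorPts (box d N)) :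
    φ x ^ 2 ≤ 2 * (bdist N (x : Site d) : ℝ) * dirichlet (box d N) φ φ := by
  obtain ⟨i, hi⟩ := exists_bdist_eq N (x : Site d)
  have hx := mem_interiorPts_box.1 x.2
  have hpos := bdist_pos x.2
  obtain ⟨k, hk⟩ := Int.eq_ofNat_of_zero_le (by omega : 0 ≤ bdist N (x : Site d))
  rw [← glue_of_mem (box d N) (fun _ => 0) φ x, hk, Int.cast_natCast]
  rcases le_total ((x : Site d) i) (N - (x : Site d) i) with h | h
  · rw [min_eq_left h] at hi
    refine sq_le_dirichlet_of_path _ φ x i (Or.inr rfl) k (fun j hj => ?_) fun hc => ?_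
    · rw [mem_interiorPts_box]
      intro l
      have := hx l
      by_cases hl : l = i
      · subst hl; simp; omega
      · simp [hl]; omega
    · have := mem_interiorPts_box.1 hc i
      simp at this
      omega
  · rw [min_eq_right h] at hi
    refine sq_le_dirichlet_of_path _ φ x i (Or.inl rfl) k (fun j hj => ?_) fun hc => ?_
    · rw [mem_interiorPts_box]
      intro l
      have := hx l
      by_cases hl : l = i
      · subst hl; simp; omega
      · simp [hl]; omega
    · have := mem_interiorPts_box.1 hc i
      simp at this
      omega

/-- The nearest face alone supplies the left side. Summing over all faces makes the bound additive
over coordinates; on the boundary, the convention `0⁻¹ = 0` keeps it true. -/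
theorem inv_bdist_le {N : ℕ} {x : Site d} (hx : x ∈ box d N) :
    (bdist N x : ℝ)⁻¹ ≤ ∑ i, (((x i : ℤ) : ℝ)⁻¹ + (((N : ℤ) - x i : ℤ) : ℝ)⁻¹) := by
  obtain ⟨i, hi⟩ := exists_bdist_eq N x
  have hb := mem_box.1 hx
  have hnn : ∀ j ∈ Finset.univ, 0 ≤ ((x j : ℤ) : ℝ)⁻¹ + (((N : ℤ) - x j : ℤ) : ℝ)⁻¹ := by
    intro j _
    have := hb j
    have h1 : (0 : ℝ) ≤ ((x j : ℤ) : ℝ) := by exact_mod_cast this.1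
    have h2 : (0 : ℝ) ≤ (((N : ℤ) - x j : ℤ) : ℝ) := by
      exact_mod_cast (by omega : (0 : ℤ) ≤ (N : ℤ) - x j)
    positivity
  refine le_trans ?_ (Finset.single_le_sum hnn (Finset.mem_univ i))
  have := hb i
  have h1 : (0 : ℝ) ≤ ((x i : ℤ) : ℝ)⁻¹ := inv_nonneg.2 (by exact_mod_cast this.1)
  have h2 : (0 : ℝ) ≤ (((N : ℤ) - x i : ℤ) : ℝ)⁻¹ := inv_nonneg.2 (by
    exact_mod_cast (by omega : (0 : ℤ) ≤ (N : ℤ) - x i))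
  rcases le_total (x i) (N - x i) with h | h
  · rw [hi, min_eq_left h]; linarith
  · rw [hi, min_eq_right h]; linarith

theorem sum_Icc_int_inv (N : ℕ) :
    ∑ b ∈ Finset.Icc (0 : ℤ) N, ((b : ℝ))⁻¹ ≤ 1 + Real.log N := by
  have h1 : Finset.Icc (0 : ℤ) N = (Finset.range (N + 1)).map Nat.castEmbedding := by
    ext b
    simp only [Finset.mem_Icc, Finset.mem_map, Finset.mem_range, Nat.castEmbedding_apply]
    constructor
    · intro hb
      exact ⟨b.toNat, by omega, by omega⟩
    · rintro ⟨n, hn, rfl⟩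
      omega
  rw [h1, Finset.sum_map, Finset.sum_range_succ']
  have := harmonic_le_one_add_log N
  rw [harmonic] at this
  push_cast at this
  simpa using this

theorem sum_inv_bdist_le (N : ℕ) :
    ∑ x ∈ box d N, (bdist N x : ℝ)⁻¹ ≤ 2 * d * ((N : ℝ) + 1) ^ (d - 1) * (1 + Real.log N) := by
  refine (Finset.sum_le_sum fun x hx => inv_bdist_le hx).trans ?_
  rw [Finset.sum_comm]
  have hinv : ∑ b ∈ Finset.Icc (0 : ℤ) N, (((N : ℤ) - b : ℤ) : ℝ)⁻¹ ≤ 1 + Real.log N := by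
    refine le_trans (le_of_eq ?_) (sum_Icc_int_inv N)
    refine Finset.sum_nbij' (fun b => (N : ℤ) - b) (fun b => (N : ℤ) - b) ?_ ?_ ?_ ?_ ?_
    · intro b hb; simp only [Finset.mem_Icc] at hb ⊢; omega
    · intro b hb; simp only [Finset.mem_Icc] at hb ⊢; omega
    · intro b _; simp
    · intro b _; simp
    · intro b _; rfl
  have hterm : ∀ i : Fin d,
      ∑ x ∈ box d N, (((x i : ℤ) : ℝ)⁻¹ + (((N : ℤ) - x i : ℤ) : ℝ)⁻¹) ≤
        ((N : ℝ) + 1) ^ (d - 1) * (2 * (1 + Real.log N)) := by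
    intro i
    have := Fintype.sum_piFinset_apply
      (fun b : ℤ => ((b : ℝ)⁻¹ + (((N : ℤ) - b : ℤ) : ℝ)⁻¹)) (Finset.Icc (0 : ℤ) N) i
    rw [box, this]
    simp only [Int.card_Icc, Fintype.card_fin, sub_zero, nsmul_eq_mul]
    push_cast
    have hN : (((N : ℤ) + 1).toNat : ℝ) = (N : ℝ) + 1 := by
      have : ((N : ℤ) + 1).toNat = N + 1 := by omega
      rw [this]; push_cast; rfl
    rw [hN]
    gcongr
    rw [Finset.sum_add_distrib]
    have := sum_Icc_int_inv N
    push_cast at hinv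
    linarith
  refine (Finset.sum_le_sum fun i _ => hterm i).trans (le_of_eq ?_)
  simp
  ring

/-- For `a ≤ b`, `(√b - √a) √b ≤ b - a ≤ 1`, so the larger argument alone suffices. Keeping both
inverses gives a form symmetric in the bond, in which a zero argument does no harm. -/
theorem sqrt_sub_sqrt_sq_le {a b : ℤ} (ha : 0 ≤ a) (hb : 0 ≤ b) (hab : a ≤ b + 1)
    (hba : b ≤ a + 1) : (√(a : ℝ) - √(b : ℝ)) ^ 2 ≤ (a : ℝ)⁻¹ + (b : ℝ)⁻¹ := by
  wlog h : a ≤ b generalizing a b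
  · have := this hb ha hba hab (by omega)
    rw [add_comm, ← neg_sub, neg_sq]
    exact this
  have ha' : (0 : ℝ) ≤ a := by exact_mod_cast ha
  have hb' : (0 : ℝ) ≤ b := by exact_mod_cast hb
  rcases hb.eq_or_lt with h0 | h0
  · have : a = 0 := by omega
    rw [← h0, this]; simp
  have hb0 : (0 : ℝ) < b := by exact_mod_cast h0
  have hba' : (b : ℝ) ≤ a + 1 := by exact_mod_cast hba
  have h' : (a : ℝ) ≤ b := by exact_mod_cast h
  suffices hs : (√(a : ℝ) - √(b : ℝ)) ^ 2 ≤ (b : ℝ)⁻¹ by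
    have : (0 : ℝ) ≤ (a : ℝ)⁻¹ := inv_nonneg.2 ha'
    linarith
  have hs1 := Real.sq_sqrt ha'
  have hs2 := Real.sq_sqrt hb'
  have hle : √(a : ℝ) ≤ √(b : ℝ) := Real.sqrt_le_sqrt h'
  have h1 := Real.sqrt_nonneg (a : ℝ)
  have h2 : 0 < √(b : ℝ) := Real.sqrt_pos.2 hb0
  have hprod : (√(b : ℝ) - √(a : ℝ)) * √(b : ℝ) ≤ 1 := by nlinarith
  have hsq : ((√(b : ℝ) - √(a : ℝ)) * √(b : ℝ)) ^ 2 ≤ 1 :=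
    pow_le_one₀ (mul_nonneg (by linarith) h2.le) hprod
  rw [← one_div, le_div_iff₀ hb0]
  nlinarith

/-- The square root of the distance to the boundary has small energy. -/
theorem dirichlet_sqrt_bdist_le (N : ℕ) {K : ℝ} (hK : 0 ≤ K) :
    dirichlet (box d N) (fun x => √(K * bdist N (x : Site d)))
        (fun x => √(K * bdist N (x : Site d))) ≤
      K * (4 * d ^ 2 * ((N : ℝ) + 1) ^ (d - 1) * (1 + Real.log N)) := by
  set u : interiorPts (box d N) → ℝ := fun x => √(K * bdist N (x : Site d))
  have hu : ∀ x ∈ box d N, glue (box d N) (fun _ => 0) u x = √K * √(bdist N x) := by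
    intro x hx
    rw [← Real.sqrt_mul hK]
    by_cases hx' : x ∈ interiorPts (box d N)
    · exact glue_of_mem (box d N) _ u ⟨x, hx'⟩
    · rw [glue_of_notMem _ _ _ hx', bdist_eq_zero hx hx']; simp
  have hinv : ∀ x ∈ box d N, (0 : ℝ) ≤ (bdist N x : ℝ)⁻¹ := fun x hx =>
    inv_nonneg.2 (by exact_mod_cast bdist_nonneg hx)
  have hterm : ∀ p ∈ bonds (box d N),
      (glue (box d N) (fun _ => 0) u p.1 - glue (box d N) (fun _ => 0) u p.2) *
        (glue (box d N) (fun _ => 0) u p.1 - glue (box d N) (fun _ => 0) u p.2) ≤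
      K * ((bdist N p.1 : ℝ)⁻¹ + (bdist N p.2 : ℝ)⁻¹) := by
    intro p hp
    obtain ⟨h1, h2, _, hadj⟩ := (mem_bonds _).1 hp
    rw [hu _ h1, hu _ h2, ← mul_sub, ← sq, mul_pow, Real.sq_sqrt hK]
    gcongr
    exact sqrt_sub_sqrt_sq_le (bdist_nonneg h1) (bdist_nonneg h2) hadj.bdist_le
      (adj_comm.1 hadj).bdist_le
  have hone : ∑ p ∈ bonds (box d N), (bdist N p.1 : ℝ)⁻¹ ≤
      2 * d * ∑ x ∈ box d N, (bdist N x : ℝ)⁻¹ := by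
    have hmap : ∀ p ∈ bonds (box d N), p.1 ∈ box d N := fun p hp => ((mem_bonds _).1 hp).1
    rw [← Finset.sum_fiberwise_of_maps_to hmap, Finset.mul_sum]
    refine Finset.sum_le_sum fun x hx => ?_
    rw [Finset.sum_congr rfl fun p hp => by rw [(Finset.mem_filter.1 hp).2], Finset.sum_const,
      nsmul_eq_mul]
    refine mul_le_mul_of_nonneg_right ?_ (hinv x hx)
    have hcard : ((bonds (box d N)).filter fun p => p.1 = x).card ≤ (nbrs x).card := by
      refine Finset.card_le_card_of_injOn Prod.snd ?_ ?_
      · intro p hp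
        obtain ⟨hp1, hp2⟩ := Finset.mem_filter.1 (Finset.mem_coe.1 hp)
        exact hp2 ▸ adj_iff_mem_nbrs.1 ((mem_bonds _).1 hp1).2.2.2
      · intro p hp q hq h
        exact Prod.ext ((Finset.mem_filter.1 hp).2.trans (Finset.mem_filter.1 hq).2.symm) h
    rw [card_nbrs] at hcard
    exact_mod_cast hcard
  have htwo : ∑ p ∈ bonds (box d N), (bdist N p.2 : ℝ)⁻¹ =
      ∑ p ∈ bonds (box d N), (bdist N p.1 : ℝ)⁻¹ := by
    refine Finset.sum_nbij' Prod.swap Prod.swap ?_ ?_ ?_ ?_ ?_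
    · intro p hp
      rw [mem_bonds] at hp ⊢
      exact ⟨hp.2.1, hp.1, hp.2.2.1.symm, adj_comm.1 hp.2.2.2⟩
    · intro p hp
      rw [mem_bonds] at hp ⊢
      exact ⟨hp.2.1, hp.1, hp.2.2.1.symm, adj_comm.1 hp.2.2.2⟩
    · intro p _; rfl
    · intro p _; rfl
    · intro p _; rfl
  rw [dirichlet_apply]
  calc _ ≤ (1 / 2) * ∑ p ∈ bonds (box d N), K * ((bdist N p.1 : ℝ)⁻¹ + (bdist N p.2 : ℝ)⁻¹) := by
        exact mul_le_mul_of_nonneg_left (Finset.sum_le_sum hterm) (by norm_num)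
    _ = K * ∑ p ∈ bonds (box d N), (bdist N p.1 : ℝ)⁻¹ := by
        rw [← Finset.mul_sum, Finset.sum_add_distrib, htwo]; ring
    _ ≤ K * (2 * d * (2 * d * ((N : ℝ) + 1) ^ (d - 1) * (1 + Real.log N))) := by
        gcongr
        refine hone.trans ?_
        gcongr
        exact sum_inv_bdist_le N
    _ = _ := by ring

end Distance

/-! ### Gaussian measures given by a positive definite form -/

section Gaussian

open scoped ENNReal

theorem form_add_self {V : Type*} [AddCommGroup V] [Module ℝ V] {B : LinearMap.BilinForm ℝ V}
    (hs : ∀ φ ψ, B φ ψ = B ψ φ) (φ ψ : V) :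
    B (φ + ψ) (φ + ψ) = B φ φ + 2 * B ψ φ + B ψ ψ := by
  simp only [map_add, LinearMap.add_apply]
  rw [hs φ ψ]; ring

variable {I : Type*} [Fintype I]

/-- The probability measure with density proportional to `exp (-B φ φ / 2)`. -/
def gaussMeasure (B : LinearMap.BilinForm ℝ (I → ℝ)) : Measure (I → ℝ) :=
  (volume : Measure (I → ℝ)).tilted fun φ => -(B φ φ / 2)

/-- The normalized density of `gaussMeasure B`. -/
def gaussDensity (B : LinearMap.BilinForm ℝ (I → ℝ)) (φ : I → ℝ) : ℝ≥0∞ :=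
  ENNReal.ofReal (Real.exp (-(B φ φ / 2)) / ∫ ψ, Real.exp (-(B ψ ψ / 2)))

variable {B : LinearMap.BilinForm ℝ (I → ℝ)} {k : I → ℝ}

theorem integrable_exp_neg_form (hc : Continuous fun φ => B φ φ) (hk : ∀ x, 0 < k x)
    (hb : ∀ φ x, φ x ^ 2 ≤ 2 * k x * B φ φ) :
    Integrable fun φ => Real.exp (-(B φ φ / 2)) := by
  set c : I → ℝ := fun x => 1 / (4 * k x * Fintype.card I)
  have hdom : ∀ φ : I → ℝ, ∑ x, c x * φ x ^ 2 ≤ B φ φ / 2 := by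
    intro φ
    rcases isEmpty_or_nonempty I with hI | hI
    · have : φ = 0 := Subsingleton.elim _ _
      simp [this]
    · have hcard : (0 : ℝ) < Fintype.card I := by exact_mod_cast Fintype.card_pos
      calc ∑ x, c x * φ x ^ 2 ≤ ∑ x : I, B φ φ / 2 / Fintype.card I := by
            refine Finset.sum_le_sum fun x _ => ?_
            have := hb φ x
            have hkx := hk x
            simp only [c]
            rw [div_mul_eq_mul_div, one_mul, div_div, div_le_div_iff₀ (by positivity) (by positivity)]
            nlinarith [mul_le_mul_of_nonneg_right this hcard.le]
        _ = B φ φ / 2 := by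
            rw [Finset.sum_const, Finset.card_univ, nsmul_eq_mul]
            field_simp
  have hprod : Integrable fun φ : I → ℝ => ∏ x, Real.exp (-c x * φ x ^ 2) := by
    rcases isEmpty_or_nonempty I with hI | hI
    · simp only [Finset.univ_eq_empty, Finset.prod_empty]
      rw [volume_pi, Measure.pi_of_empty (fun _ : I => (volume : Measure ℝ)) 0]
      exact integrable_const _
    · refine Integrable.fintype_prod (f := fun x t => Real.exp (-c x * t ^ 2)) fun x => ?_
      have hcard : (0 : ℝ) < Fintype.card I := by exact_mod_cast Fintype.card_pos
      have := hk x
      exact integrable_exp_neg_mul_sq (by simp only [c]; positivity)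
  refine hprod.mono' (by fun_prop) (ae_of_all _ fun φ => ?_)
  rw [Real.norm_eq_abs, abs_of_pos (Real.exp_pos _), ← Real.exp_sum]
  refine Real.exp_le_exp.2 ?_
  have := hdom φ
  simp only [neg_mul, Finset.sum_neg_distrib]
  linarith

theorem measurable_gaussDensity (hc : Continuous fun φ => B φ φ) :
    Measurable (gaussDensity B) := by
  unfold gaussDensity
  have := hc.measurable
  fun_prop

theorem lintegral_gaussMeasure (g : (I → ℝ) → ℝ≥0∞) :
    ∫⁻ φ, g φ ∂gaussMeasure B = ∫⁻ φ, gaussDensity B φ * g φ :=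
  lintegral_tilted _ _

theorem gaussMeasure_apply {s : Set (I → ℝ)} (hs : MeasurableSet s) :
    gaussMeasure B s = ∫⁻ φ in s, gaussDensity B φ :=
  tilted_apply' _ _ hs

theorem isProbabilityMeasure_gaussMeasure (hc : Continuous fun φ => B φ φ) (hk : ∀ x, 0 < k x)
    (hb : ∀ φ x, φ x ^ 2 ≤ 2 * k x * B φ φ) : IsProbabilityMeasure (gaussMeasure B) :=
  isProbabilityMeasure_tilted (integrable_exp_neg_form hc hk hb)

/-- The coordinate bounds make `B` non-degenerate, hence in finite dimension every functional is
represented. The representative is the direction of the shift in the tail estimate. -/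
theorem exists_form_eq_eval (hb : ∀ φ x, φ x ^ 2 ≤ 2 * k x * B φ φ) (t : ℝ) (x : I) :
    ∃ ψ, ∀ φ : I → ℝ, B ψ φ = t * φ x := by
  have hinj : Function.Injective B := by
    rw [← LinearMap.ker_eq_bot, LinearMap.ker_eq_bot']
    intro ψ hψ
    ext x
    have := hb ψ x
    rw [hψ] at this
    simp at this
    simpa using this
  have hsurj := (LinearMap.injective_iff_surjective_of_finrank_eq_finrank
    (Subspace.dual_finrank_eq (K := ℝ) (V := I → ℝ)).symm).1 hinj
  obtain ⟨ψ, hψ⟩ := hsurj (t • LinearMap.proj x)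
  exact ⟨ψ, fun φ => by rw [hψ]; simp⟩

/-- Exponential Chebyshev carried out as a translation: on the event the density is at most a small
constant times its translate by the representative of evaluation at `x`, and the translate has mass
one. -/
theorem gaussMeasure_tail (hs : ∀ φ ψ, B φ ψ = B ψ φ) (hc : Continuous fun φ => B φ φ)
    (hk : ∀ x, 0 < k x) (hb : ∀ φ x, φ x ^ 2 ≤ 2 * k x * B φ φ) (x : I) {σ s : ℝ}
    (hσ : σ ^ 2 = 1) (hs0 : 0 ≤ s) :
    gaussMeasure B {φ | s ≤ σ * φ x} ≤ ENNReal.ofReal (Real.exp (-(s ^ 2 / (4 * k x)))) := by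
  have := isProbabilityMeasure_gaussMeasure hc hk hb
  have hkx := hk x
  -- This maximizes `t s - k t^2`, with value `s^2 / (4 k)`.
  set t := s / (2 * k x)
  have ht : 0 ≤ t := by positivity
  have hts : s = 2 * k x * t := by simp only [t]; field_simp
  obtain ⟨ψ, hψ⟩ := exists_form_eq_eval hb (t * σ) x
  -- Since `B ψ ψ = t σ ψ_x`, the hypothesis `hb` applied to `ψ` itself bounds `σ ψ_x` by `2 k t`.
  have hψψ : B ψ ψ / 2 ≤ k x * t ^ 2 := by
    have h1 := hψ ψ
    have h2 := hb ψ x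
    rw [h1] at h2 ⊢
    have h3 : (ψ x * σ) ^ 2 ≤ 2 * k x * t * (ψ x * σ) := by nlinarith
    by_cases h4 : ψ x * σ ≤ 0
    · have : 0 ≤ k x * t ^ 2 := by positivity
      nlinarith
    · push Not at h4
      have : ψ x * σ ≤ 2 * k x * t := by
        by_contra! hcon
        nlinarith
      nlinarith
  have hmeas : MeasurableSet {φ : I → ℝ | s ≤ σ * φ x} :=
    measurableSet_le measurable_const (by fun_prop)
  have hpt : ∀ φ ∈ {φ : I → ℝ | s ≤ σ * φ x}, gaussDensity B φ ≤
      ENNReal.ofReal (Real.exp (-(s ^ 2 / (4 * k x)))) * gaussDensity B (φ - ψ) := by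
    intro φ hφ
    simp only [Set.mem_ofPred_eq] at hφ
    rw [gaussDensity, gaussDensity, ← ENNReal.ofReal_mul (Real.exp_nonneg _), ← mul_div_assoc,
      ← Real.exp_add]
    have hZ : 0 ≤ ∫ ψ, Real.exp (-(B ψ ψ / 2)) := integral_nonneg fun _ => (Real.exp_pos _).le
    gcongr
    have h1 : B (φ - ψ) (φ - ψ) = B φ φ - 2 * B ψ φ + B ψ ψ := by
      simp only [map_sub, LinearMap.sub_apply]
      rw [hs φ ψ]; ring
    have h2 : s ^ 2 / (4 * k x) = k x * t ^ 2 := by rw [hts]; field_simp; ring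
    rw [h1, h2, hψ φ]
    nlinarith [mul_le_mul_of_nonneg_left hφ ht]
  rw [gaussMeasure_apply hmeas]
  have hm := measurable_gaussDensity hc
  calc ∫⁻ φ in {φ | s ≤ σ * φ x}, gaussDensity B φ
      ≤ ∫⁻ φ in {φ | s ≤ σ * φ x},
          ENNReal.ofReal (Real.exp (-(s ^ 2 / (4 * k x)))) * gaussDensity B (φ - ψ) :=
        setLIntegral_mono' hmeas hpt
    _ ≤ ∫⁻ φ, ENNReal.ofReal (Real.exp (-(s ^ 2 / (4 * k x)))) * gaussDensity B (φ - ψ) :=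
        setLIntegral_le_lintegral _ _
    _ = ENNReal.ofReal (Real.exp (-(s ^ 2 / (4 * k x)))) * gaussMeasure B Set.univ := by
        rw [lintegral_const_mul _ (by fun_prop), lintegral_sub_right_eq_self (gaussDensity B),
          gaussMeasure_apply MeasurableSet.univ, setLIntegral_univ]
    _ = _ := by simp

theorem gaussMeasure_abs_tail (hs : ∀ φ ψ, B φ ψ = B ψ φ) (hc : Continuous fun φ => B φ φ)
    (hk : ∀ x, 0 < k x) (hb : ∀ φ x, φ x ^ 2 ≤ 2 * k x * B φ φ) (x : I) {s : ℝ} (hs0 : 0 ≤ s) :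
    gaussMeasure B {φ | s ≤ |φ x|} ≤ 2 * ENNReal.ofReal (Real.exp (-(s ^ 2 / (4 * k x)))) := by
  have hsub : {φ : I → ℝ | s ≤ |φ x|} ⊆ {φ | s ≤ 1 * φ x} ∪ {φ | s ≤ -1 * φ x} := by
    intro φ hφ
    simp only [Set.mem_ofPred_eq, le_abs] at hφ
    simpa using hφ
  refine (measure_mono hsub).trans ((measure_union_le _ _).trans ?_)
  rw [two_mul]
  exact add_le_add (gaussMeasure_tail hs hc hk hb x (by norm_num) hs0)
    (gaussMeasure_tail hs hc hk hb x (by norm_num) hs0)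

/-- Shifting a symmetric set by `u` costs at most the factor `exp (-B u u / 2)`. -/
theorem gaussMeasure_shift (hs : ∀ φ ψ, B φ ψ = B ψ φ) (hc : Continuous fun φ => B φ φ)
    (u : I → ℝ) {D G : Set (I → ℝ)} (hD : MeasurableSet D) (hG : MeasurableSet G)
    (hsym : ∀ φ, φ ∈ D → -φ ∈ D) (hDG : ∀ φ ∈ D, φ + u ∈ G) :
    ENNReal.ofReal (Real.exp (-(B u u / 2))) * gaussMeasure B D ≤ gaussMeasure B G := by
  have hm := measurable_gaussDensity hc
  have hshift : ∫⁻ φ in D, gaussDensity B (φ + u) ≤ gaussMeasure B G := by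
    rw [gaussMeasure_apply hG, ← lintegral_indicator hG, ← lintegral_indicator hD,
      ← lintegral_add_right_eq_self (G.indicator (gaussDensity B)) u]
    refine lintegral_mono fun φ => ?_
    by_cases hφ : φ ∈ D
    · rw [Set.indicator_of_mem hφ, Set.indicator_of_mem (hDG φ hφ)]
    · rw [Set.indicator_of_notMem hφ]; exact zero_le
  have hneg : ∫⁻ φ in D, gaussDensity B (-φ + u) = ∫⁻ φ in D, gaussDensity B (φ + u) := by
    rw [← lintegral_indicator hD, ← lintegral_indicator hD,
      ← lintegral_neg_eq_self (D.indicator fun φ => gaussDensity B (φ + u))]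
    refine lintegral_congr fun φ => ?_
    by_cases hφ : φ ∈ D
    · rw [Set.indicator_of_mem hφ, Set.indicator_of_mem (hsym φ hφ)]
    · rw [Set.indicator_of_notMem hφ, Set.indicator_of_notMem]
      intro h
      exact hφ (by simpa using hsym _ h)
  -- Averaging over `φ` and `-φ` turns the linear term of the shift into a hyperbolic cosine, which
  -- is at least one; this is why `D` must be symmetric.
  have hpt : ∀ φ, 2 * (ENNReal.ofReal (Real.exp (-(B u u / 2))) * gaussDensity B φ) ≤
      gaussDensity B (φ + u) + gaussDensity B (-φ + u) := by
    intro φ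
    have hZ : 0 ≤ ∫ ψ, Real.exp (-(B ψ ψ / 2)) := integral_nonneg fun _ => (Real.exp_pos _).le
    simp only [gaussDensity]
    rw [← ENNReal.ofReal_add (by positivity) (by positivity),
      ← ENNReal.ofReal_mul (Real.exp_nonneg _), ← ENNReal.ofReal_ofNat 2,
      ← ENNReal.ofReal_mul (by norm_num), ← add_div, ← mul_div_assoc, ← mul_div_assoc,
      ← Real.exp_add]
    refine ENNReal.ofReal_le_ofReal (div_le_div_of_nonneg_right ?_ hZ)
    have h1 := form_add_self hs φ u
    have h2 := form_add_self hs (-φ) u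
    simp only [map_neg, LinearMap.neg_apply, neg_neg] at h2
    rw [h1, h2]
    have e1 : -((B φ φ + 2 * B u φ + B u u) / 2) =
        (-(B u u / 2) + -(B φ φ / 2)) + -(B u φ) := by ring
    have e2 : -((B φ φ + 2 * -(B u φ) + B u u) / 2) =
        (-(B u u / 2) + -(B φ φ / 2)) + B u φ := by ring
    rw [e1, e2, Real.exp_add _ (-(B u φ)), Real.exp_add _ (B u φ), ← mul_add, mul_comm]
    gcongr
    have h3 := Real.add_one_le_exp (B u φ)
    have h4 := Real.add_one_le_exp (-(B u φ))
    linarith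
  have hfin : 2 * (ENNReal.ofReal (Real.exp (-(B u u / 2))) * gaussMeasure B D) ≤
      2 * gaussMeasure B G := by
    calc 2 * (ENNReal.ofReal (Real.exp (-(B u u / 2))) * gaussMeasure B D)
        = ∫⁻ φ in D, 2 * (ENNReal.ofReal (Real.exp (-(B u u / 2))) * gaussDensity B φ) := by
          rw [lintegral_const_mul _ (by fun_prop), lintegral_const_mul _ hm,
            gaussMeasure_apply hD]
      _ ≤ ∫⁻ φ in D, (gaussDensity B (φ + u) + gaussDensity B (-φ + u)) :=
          lintegral_mono fun φ => hpt φ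
      _ = 2 * ∫⁻ φ in D, gaussDensity B (φ + u) := by
          rw [lintegral_add_left (by fun_prop), hneg, two_mul]
      _ ≤ 2 * gaussMeasure B G := by gcongr
  exact (ENNReal.mul_le_mul_iff_right (by norm_num) (by norm_num)).1 hfin

/-- A positive definite Gaussian field stays above `1` everywhere with a probability that is
bounded below by the cost of a shift proportional to the square root of the variances. -/
theorem gaussMeasure_one_lt_ge (hs : ∀ φ ψ, B φ ψ = B ψ φ) (hc : Continuous fun φ => B φ φ)
    (hk : ∀ x, 1 ≤ k x) (hb : ∀ φ x, φ x ^ 2 ≤ 2 * k x * B φ φ) {K : ℝ} (hK : 4 ≤ K)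
    (hcard : 4 * (Fintype.card I : ℝ) ≤ Real.exp (K / 16)) :
    ENNReal.ofReal (Real.exp (-(B (fun x => √(K * k x)) (fun x => √(K * k x)) / 2)) / 2) ≤
      gaussMeasure B {φ | ∀ x, 1 < φ x} := by
  have hk0 : ∀ x, 0 < k x := fun x => lt_of_lt_of_le one_pos (hk x)
  have := isProbabilityMeasure_gaussMeasure hc hk0 hb
  set u : I → ℝ := fun x => √(K * k x)
  set D : Set (I → ℝ) := {φ | ∀ x, |φ x| < u x - 1}
  have hD : MeasurableSet D := by
    simp only [D, Set.ofPred_forall]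
    exact MeasurableSet.iInter fun x => measurableSet_lt (by fun_prop) measurable_const
  have hG : MeasurableSet {φ : I → ℝ | ∀ x, 1 < φ x} := by
    simp only [Set.ofPred_forall]
    exact MeasurableSet.iInter fun x => measurableSet_lt measurable_const (by fun_prop)
  have hu2 : ∀ x, 2 ≤ u x := fun x => by
    refine Real.le_sqrt_of_sq_le ?_
    nlinarith [hk x]
  -- As `u ≥ 2`, `(u - 1)^2 ≥ u^2 / 4 = K k / 4`, whence the exponent `K / 16` from the tail bound.
  have hterm : ∀ x, gaussMeasure B {φ | u x - 1 ≤ |φ x|} ≤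
      ENNReal.ofReal (2 * Real.exp (-(K / 16))) := by
    intro x
    refine (gaussMeasure_abs_tail hs hc hk0 hb x (by linarith [hu2 x])).trans ?_
    rw [ENNReal.ofReal_mul (by norm_num), ENNReal.ofReal_ofNat]
    refine mul_le_mul_right (ENNReal.ofReal_le_ofReal
      (Real.exp_le_exp.2 (neg_le_neg ?_))) _
    have h1 := hu2 x
    have hsq : u x ^ 2 = K * k x := Real.sq_sqrt (by nlinarith [hk0 x])
    have hkx := hk0 x
    rw [div_le_div_iff₀ (by norm_num) (by positivity)]
    nlinarith
  have hDc : gaussMeasure B Dᶜ ≤ ENNReal.ofReal (1 / 2) := by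
    have : Dᶜ ⊆ ⋃ x, {φ : I → ℝ | u x - 1 ≤ |φ x|} := by
      intro φ hφ
      simp only [D, Set.mem_compl_iff, Set.mem_ofPred_eq, not_forall, not_lt] at hφ
      simpa using hφ
    refine (measure_mono this).trans ((measure_iUnion_fintype_le _ _).trans ?_)
    refine (Finset.sum_le_sum fun x _ => hterm x).trans ?_
    rw [Finset.sum_const, Finset.card_univ, nsmul_eq_mul, ← ENNReal.ofReal_natCast,
      ← ENNReal.ofReal_mul (by positivity)]
    refine ENNReal.ofReal_le_ofReal ?_
    rw [Real.exp_neg]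
    have := Real.exp_pos (K / 16)
    rw [← mul_assoc, mul_inv_le_iff₀ this]
    linarith
  have hDge : ENNReal.ofReal (1 / 2) ≤ gaussMeasure B D := by
    have h1 : gaussMeasure B D + gaussMeasure B Dᶜ = 1 := prob_add_prob_compl hD
    have h2 : (1 : ℝ≥0∞) = ENNReal.ofReal (1 / 2) + ENNReal.ofReal (1 / 2) := by
      rw [← ENNReal.ofReal_add (by norm_num) (by norm_num)]; norm_num
    by_contra! hcon
    have : gaussMeasure B D + gaussMeasure B Dᶜ < 1 := by
      conv_rhs => rw [h2]
      exact ENNReal.add_lt_add_of_lt_of_le (ne_top_of_le_ne_top (by simp) hDc) hcon hDc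
    exact absurd h1 this.ne
  have hshift := gaussMeasure_shift hs hc u hD hG
    (fun φ hφ x => by simpa using hφ x)
    (fun φ hφ x => by
      have := (abs_lt.1 (hφ x)).1
      simp only [Pi.add_apply]
      linarith)
  refine le_trans ?_ hshift
  rw [div_eq_mul_one_div, ENNReal.ofReal_mul (Real.exp_nonneg _)]
  gcongr

/-- With the other coordinates frozen, completing the square shows that coordinate `x` has density
proportional to `exp(-a (t - m)^2)`. The mean depends on the frozen coordinates, so uniformity of
`hC` in `m` is exactly what is needed. -/
theorem lintegral_gaussMeasure_coord_le [DecidableEq I] (hs : ∀ φ ψ, B φ ψ = B ψ φ)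
    (hc : Continuous fun φ => B φ φ) {a : ℝ} (ha : 0 < a) (x : I)
    (hdiag : B (Pi.single x 1) (Pi.single x 1) = 2 * a) {f : ℝ → ℝ≥0∞} (hf : Measurable f)
    {C : ℝ≥0∞}
    (hC : ∀ m : ℝ, ∫⁻ t, ENNReal.ofReal (Real.exp (-(a * (t - m) ^ 2))) * f t ≤
      C * ∫⁻ t, ENNReal.ofReal (Real.exp (-(a * (t - m) ^ 2))))
    {F : (I → ℝ) → ℝ≥0∞} (hF : Measurable F) (hFx : ∀ φ t, F (Function.update φ x t) = F φ) :
    ∫⁻ φ, f (φ x) * F φ ∂gaussMeasure B ≤ C * ∫⁻ φ, F φ ∂gaussMeasure B := by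
  have hm := measurable_gaussDensity hc
  rw [← lintegral_const_mul _ hF, lintegral_gaussMeasure, lintegral_gaussMeasure, volume_pi]
  refine lintegral_le_of_lmarginal_le {x} (by fun_prop) (by fun_prop) ?_
  rw [lmarginal_singleton, lmarginal_singleton]
  intro φ
  set φ₀ := Function.update φ x 0
  set b := B (Pi.single x 1) φ₀
  have hupd : ∀ t, Function.update φ x t = φ₀ + t • Pi.single x 1 := by
    intro t
    ext y
    by_cases hy : y = x
    · subst hy; simp [φ₀]
    · simp [φ₀, hy]
  have hdens : ∀ t, gaussDensity B (Function.update φ x t) =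
      ENNReal.ofReal (Real.exp (b ^ 2 / (4 * a) - B φ₀ φ₀ / 2) / ∫ ψ, Real.exp (-(B ψ ψ / 2))) *
        ENNReal.ofReal (Real.exp (-(a * (t - -(b / (2 * a))) ^ 2))) := by
    intro t
    have hZ : 0 ≤ ∫ ψ, Real.exp (-(B ψ ψ / 2)) := integral_nonneg fun _ => (Real.exp_pos _).le
    rw [← ENNReal.ofReal_mul (by positivity), gaussDensity, div_mul_eq_mul_div, ← Real.exp_add,
      hupd, form_add_self hs]
    congr 3
    simp only [map_smul, LinearMap.smul_apply, smul_eq_mul, hdiag]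
    field_simp
    ring
  simp only [hdens, hFx, Function.update_self]
  set A := ENNReal.ofReal
    (Real.exp (b ^ 2 / (4 * a) - B φ₀ φ₀ / 2) / ∫ ψ, Real.exp (-(B ψ ψ / 2)))
  calc _ = ∫⁻ t, (A * F φ) *
        (ENNReal.ofReal (Real.exp (-(a * (t - -(b / (2 * a))) ^ 2))) * f t) := by
        refine lintegral_congr fun t => ?_
        ring
    _ = (A * F φ) * ∫⁻ t, ENNReal.ofReal (Real.exp (-(a * (t - -(b / (2 * a))) ^ 2))) * f t := by
        rw [lintegral_const_mul _ (by fun_prop)]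
    _ ≤ (A * F φ) * (C * ∫⁻ t, ENNReal.ofReal (Real.exp (-(a * (t - -(b / (2 * a))) ^ 2)))) := by
        gcongr
        exact hC _
    _ = ∫⁻ t, (A * F φ * C) *
        ENNReal.ofReal (Real.exp (-(a * (t - -(b / (2 * a))) ^ 2))) := by
        rw [lintegral_const_mul _ (by fun_prop)]
        ring
    _ = _ := by
        refine lintegral_congr fun t => ?_
        ring

/-- A bound on one-site expectations that is uniform in the conditional mean propagates to the
expectation of a product over all sites. -/
theorem lintegral_gaussMeasure_prod_le [DecidableEq I] (hs : ∀ φ ψ, B φ ψ = B ψ φ)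
    (hc : Continuous fun φ => B φ φ) (hk : ∀ x, 0 < k x)
    (hb : ∀ φ x, φ x ^ 2 ≤ 2 * k x * B φ φ) {a : ℝ} (ha : 0 < a)
    (hdiag : ∀ x, B (Pi.single x 1) (Pi.single x 1) = 2 * a) {f : ℝ → ℝ≥0∞} (hf : Measurable f)
    {C : ℝ≥0∞}
    (hC : ∀ m : ℝ, ∫⁻ t, ENNReal.ofReal (Real.exp (-(a * (t - m) ^ 2))) * f t ≤
      C * ∫⁻ t, ENNReal.ofReal (Real.exp (-(a * (t - m) ^ 2)))) :
    ∫⁻ φ, ∏ x, f (φ x) ∂gaussMeasure B ≤ C ^ Fintype.card I := by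
  have := isProbabilityMeasure_gaussMeasure hc hk hb
  rw [← Finset.card_univ]
  -- Induction over subsets: the product over the sites already treated does not depend on the new
  -- coordinate.
  generalize (Finset.univ : Finset I) = S
  induction S using Finset.induction_on with
  | empty => simp
  | insert x S hx ih =>
    simp only [Finset.prod_insert hx]
    refine (lintegral_gaussMeasure_coord_le hs hc ha x (hdiag x) hf hC
      (F := fun φ => ∏ y ∈ S, f (φ y)) (by fun_prop) fun φ t => ?_).trans ?_
    · refine Finset.prod_congr rfl fun y hy => ?_
      rw [Function.update_of_ne]
      rintro rfl
      exact hx hy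
    · rw [Finset.card_insert_of_notMem hx, pow_succ']
      gcongr

end Gaussian

/-! ### One-site Gaussian estimate -/

section OneSite

variable {a : ℝ}

theorem integrable_exp_neg_mul_sub_sq (ha : 0 < a) (m : ℝ) :
    Integrable fun t : ℝ => Real.exp (-(a * (t - m) ^ 2)) := by
  have := (integrable_exp_neg_mul_sq ha).comp_sub_right m
  simpa only [neg_mul] using this

theorem integral_exp_neg_mul_sub_sq (a m : ℝ) :
    ∫ t : ℝ, Real.exp (-(a * (t - m) ^ 2)) = √(Real.pi / a) := by
  rw [← integral_gaussian a,
    ← integral_sub_right_eq_self (fun t : ℝ => Real.exp (-a * t ^ 2)) m]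
  simp only [neg_mul]

/-- A Gaussian whose mean is far outside `[-r, r]` gives little mass to `[-r, r]`. -/
theorem setIntegral_gaussian_far_le (ha : 0 < a) {m r R : ℝ} (hR : 0 ≤ R) (hm : r + R ≤ |m|) :
    ∫ t in Set.Icc (-r) r, Real.exp (-(a * (t - m) ^ 2)) ≤
      2 * Real.exp (-(a * R ^ 2 / 2)) * √(Real.pi / a) := by
  have hint := (integrable_exp_neg_mul_sub_sq (half_pos ha) m).const_mul
    (Real.exp (-(a * R ^ 2 / 2)))
  calc ∫ t in Set.Icc (-r) r, Real.exp (-(a * (t - m) ^ 2))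
      ≤ ∫ t in Set.Icc (-r) r,
          Real.exp (-(a * R ^ 2 / 2)) * Real.exp (-(a / 2 * (t - m) ^ 2)) := by
        refine setIntegral_mono_on (integrable_exp_neg_mul_sub_sq ha m).integrableOn
          hint.integrableOn measurableSet_Icc fun t ht => ?_
        rw [← Real.exp_add, Real.exp_le_exp]
        have h1 : R ≤ |t - m| := by
          have h2 := abs_le.2 ht
          have h3 := abs_sub_abs_le_abs_sub m t
          rw [abs_sub_comm] at h3
          linarith
        have h4 : R ^ 2 ≤ (t - m) ^ 2 := by
          rw [← sq_abs (t - m)]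
          exact pow_le_pow_left₀ hR h1 2
        nlinarith
    _ ≤ ∫ t : ℝ, Real.exp (-(a * R ^ 2 / 2)) * Real.exp (-(a / 2 * (t - m) ^ 2)) :=
        setIntegral_le_integral hint (ae_of_all _ fun t => by positivity)
    _ = Real.exp (-(a * R ^ 2 / 2)) * √(Real.pi / (a / 2)) := by
        rw [integral_const_mul, integral_exp_neg_mul_sub_sq]
    _ ≤ 2 * Real.exp (-(a * R ^ 2 / 2)) * √(Real.pi / a) := by
        have : √(Real.pi / (a / 2)) ≤ 2 * √(Real.pi / a) := by
          rw [Real.sqrt_le_left (by positivity), mul_pow, Real.sq_sqrt (by positivity)]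
          rw [div_div_eq_mul_div, mul_comm, mul_div_assoc]
          have : 0 < Real.pi / a := by positivity
          linarith
        nlinarith [Real.exp_pos (-(a * R ^ 2 / 2))]

theorem le_setIntegral_gaussian_contact (ha : 0 < a) {m M : ℝ} (hm : |m| + 1 ≤ M) :
    2 * Real.exp (-(a * M ^ 2)) ≤ ∫ t in Set.Icc (-1 : ℝ) 1, Real.exp (-(a * (t - m) ^ 2)) := by
  calc 2 * Real.exp (-(a * M ^ 2))
      = ∫ _ in Set.Icc (-1 : ℝ) 1, Real.exp (-(a * M ^ 2)) := by
        rw [setIntegral_const]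
        norm_num
    _ ≤ _ := by
        refine setIntegral_mono_on (by simp) (integrable_exp_neg_mul_sub_sq ha m).integrableOn
          measurableSet_Icc fun t ht => ?_
        rw [Real.exp_le_exp]
        have h1 : |t - m| ≤ M := by
          have h2 := abs_le.2 ht
          have h3 := abs_sub t m
          linarith
        have h4 : (t - m) ^ 2 ≤ M ^ 2 := by
          rw [← sq_abs (t - m)]
          exact pow_le_pow_left₀ (abs_nonneg _) h1 2
        nlinarith

/-- The reward for a low site against the cost of a contact. -/
def lowWeight (θ r t : ℝ) : ℝ :=
  Real.exp (θ * Set.indicator (Set.Icc (-r) r) (fun _ => 1) t - contact t)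

theorem measurable_contact : Measurable contact :=
  measurable_const.indicator measurableSet_Icc

theorem measurable_lowWeight (θ r : ℝ) : Measurable (lowWeight θ r) := by
  have h1 : Measurable (Set.indicator (Set.Icc (-r) r) fun _ : ℝ => (1 : ℝ)) :=
    measurable_const.indicator measurableSet_Icc
  have h2 := measurable_contact
  unfold lowWeight
  fun_prop

/-- Linearization by `exp θ ≤ 1 + 2θ` and `exp(-1) ≤ 1/2`; because `r ≥ 1`, every contact is also a
low site, which leaves three cases. -/
theorem lowWeight_le {θ r : ℝ} (hθ : 0 ≤ θ) (hθ1 : θ ≤ 1) (hr : 1 ≤ r) (t : ℝ) :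
    lowWeight θ r t ≤ 1 + 2 * θ * Set.indicator (Set.Icc (-r) r) (fun _ => 1) t -
      1 / 2 * Set.indicator (Set.Icc (-1) 1) (fun _ => 1) t := by
  have hexp : Real.exp θ ≤ 1 + 2 * θ := by
    have h1 := Real.abs_exp_sub_one_le (x := θ) (by rw [abs_of_nonneg hθ]; exact hθ1)
    rw [abs_of_nonneg hθ] at h1
    linarith [le_abs_self (Real.exp θ - 1)]
  have hone : Real.exp (-1) ≤ 1 / 2 := by
    rw [Real.exp_neg, one_div]
    exact inv_anti₀ (by norm_num) (by linarith [Real.add_one_le_exp (1 : ℝ)])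
  rw [lowWeight, contact]
  by_cases h1 : t ∈ Set.Icc (-1 : ℝ) 1
  · have h2 : t ∈ Set.Icc (-r) r := ⟨by linarith [h1.1], by linarith [h1.2]⟩
    rw [Set.indicator_of_mem h1, Set.indicator_of_mem h2, sub_eq_add_neg (θ * 1), Real.exp_add,
      mul_one]
    nlinarith [Real.exp_pos (-1), Real.exp_pos θ]
  · rw [Set.indicator_of_notMem h1]
    by_cases h2 : t ∈ Set.Icc (-r) r
    · rw [Set.indicator_of_mem h2]
      simpa using hexp
    · rw [Set.indicator_of_notMem h2]
      simp

/-- For every mean `m`, the Gaussian expectation of `lowWeight` is at most `exp (θ ε / 4)`, with a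
reward `θ` of order `h ^ (1/3)`. -/
theorem exists_lowWeight_bound (ha : 0 < a) {ε : ℝ} (hε : 0 < ε) :
    ∃ c : ℝ, 0 < c ∧ ∃ h₁ : ℝ, 0 < h₁ ∧ ∀ h : ℝ, 0 < h → h < h₁ → ∀ m : ℝ,
      ∫⁻ t, ENNReal.ofReal (Real.exp (-(a * (t - m) ^ 2))) *
          ENNReal.ofReal (lowWeight (c * Real.exp (Real.log h / 3))
            √(1 / (4 * a) * Real.log (1 / h)) t) ≤
        ENNReal.ofReal (Real.exp (c * Real.exp (Real.log h / 3) * ε / 4)) *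
          ∫⁻ t, ENNReal.ofReal (Real.exp (-(a * (t - m) ^ 2))) := by
  set J := √(Real.pi / a)
  have hJ : 0 < J := Real.sqrt_pos.2 (div_pos Real.pi_pos ha)
  set l := |Real.log (ε / 16)|
  -- A mean further than `R` outside the low window leaves it a mass fraction of at most `ε / 8`.
  set R := √(2 * l / a)
  have hl : 0 ≤ l := abs_nonneg _
  have hR : 0 ≤ R := Real.sqrt_nonneg _
  have hRl : Real.exp (-(a * R ^ 2 / 2)) ≤ ε / 16 := by
    rw [Real.sq_sqrt (by positivity)]
    have : a * (2 * l / a) / 2 = l := by field_simp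
    rw [this]
    calc Real.exp (-l) ≤ Real.exp (Real.log (ε / 16)) :=
          Real.exp_le_exp.2 (neg_abs_le _)
      _ = ε / 16 := Real.exp_log (by positivity)
  set c₀ := Real.exp (-(4 * a * (R + 1) ^ 2))
  have hc₀ : 0 < c₀ := Real.exp_pos _
  set c := min 1 (c₀ / (2 * J))
  have hc : 0 < c := lt_min one_pos (by positivity)
  -- This threshold on `h` amounts to `r ≥ 1`.
  refine ⟨c, hc, Real.exp (-(4 * a)), Real.exp_pos _, fun h hh hh1 m => ?_⟩
  have hlog : 4 * a < -Real.log h := by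
    have := Real.log_lt_log hh hh1
    rw [Real.log_exp] at this
    linarith
  set y := Real.exp (Real.log h / 3)
  have hy : 0 < y := Real.exp_pos _
  have hy1 : y ≤ 1 := Real.exp_le_one_iff.2 (by linarith)
  set θ := c * y
  have hθ : 0 < θ := mul_pos hc hy
  have hθ1 : θ ≤ 1 := mul_le_one₀ (min_le_left _ _) hy.le hy1
  set r := √(1 / (4 * a) * Real.log (1 / h))
  have hlog' : Real.log (1 / h) = -Real.log h := by rw [one_div, Real.log_inv]
  have hr2 : r ^ 2 = 1 / (4 * a) * -Real.log h := by
    rw [Real.sq_sqrt, hlog']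
    rw [hlog']
    have : 0 < -Real.log h := by linarith
    positivity
  have hr : 1 ≤ r := by
    refine Real.le_sqrt_of_sq_le ?_
    rw [hlog', div_mul_eq_mul_div, one_mul, le_div_iff₀ (by positivity)]
    linarith
  set g : ℝ → ℝ := fun t => Real.exp (-(a * (t - m) ^ 2))
  have hg : Integrable g := integrable_exp_neg_mul_sub_sq ha m
  have hg0 : ∀ t, 0 ≤ g t := fun t => (Real.exp_pos _).le
  have hgJ : ∫ t, g t = J := integral_exp_neg_mul_sub_sq a m
  set Low := ∫ t in Set.Icc (-r) r, g t
  set Con := ∫ t in Set.Icc (-1 : ℝ) 1, g t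
  have hLowJ : Low ≤ J := hgJ ▸ setIntegral_le_integral hg (ae_of_all _ hg0)
  have hCon : 0 ≤ Con := integral_nonneg hg0
  -- For a far mean, `Low` is already small. For a near mean, the contact mass pays for even the
  -- full mass `J` in place of `Low`.
  have hkey : 2 * θ * Low - 1 / 2 * Con ≤ θ * ε / 4 * J := by
    rcases le_or_gt (r + R) |m| with hm | hm
    · have h1 : Low ≤ 2 * Real.exp (-(a * R ^ 2 / 2)) * J :=
        setIntegral_gaussian_far_le ha hR hm
      have h2 : Low ≤ ε / 8 * J := by nlinarith
      nlinarith
    · have h1 : 2 * Real.exp (-(a * (r + R + 1) ^ 2)) ≤ Con :=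
        le_setIntegral_gaussian_contact ha (by linarith)
      have h2 : y * c₀ ≤ Real.exp (-(a * (r + R + 1) ^ 2)) := by
        rw [← Real.exp_add, Real.exp_le_exp]
        -- The cross term is absorbed by enlarging `r^2` by `4/3`: since `exp(-a r^2) = h^(1/4)`,
        -- this is where the exponent `1/3` comes from.
        have h3 : (r + R + 1) ^ 2 ≤ 4 / 3 * r ^ 2 + 4 * (R + 1) ^ 2 := by
          nlinarith [sq_nonneg (r - 3 * (R + 1))]
        have h4 : a * (4 / 3 * r ^ 2) = -(Real.log h / 3) := by
          rw [hr2]; field_simp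
        nlinarith [mul_le_mul_of_nonneg_left h3 ha.le]
      have h3 : 4 * θ * J ≤ 2 * (y * c₀) := by
        have h4 : c ≤ c₀ / (2 * J) := min_le_right _ _
        rw [le_div_iff₀ (by positivity)] at h4
        have : 4 * θ * J = 2 * (y * (c * (2 * J))) := by simp only [θ]; ring
        rw [this]
        gcongr
      have h5 : 0 ≤ θ * ε / 4 * J := by positivity
      nlinarith
  have hind : ∀ s : Set ℝ, MeasurableSet s →
      Integrable (fun t => g t * s.indicator (fun _ => 1) t) := by
    intro s hs
    have : (fun t => g t * s.indicator (fun _ => 1) t) = s.indicator g := by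
      ext t
      by_cases ht : t ∈ s <;> simp [ht]
    rw [this]
    exact hg.indicator hs
  have hindI : ∀ s : Set ℝ, MeasurableSet s →
      ∫ t, g t * s.indicator (fun _ => 1) t = ∫ t in s, g t := by
    intro s hs
    rw [← integral_indicator hs]
    refine integral_congr_ae (ae_of_all _ fun t => ?_)
    by_cases ht : t ∈ s <;> simp [ht]
  have i1 := (hind _ (measurableSet_Icc (a := -r) (b := r))).const_mul (2 * θ)
  have i2 := (hind _ (measurableSet_Icc (a := (-1 : ℝ)) (b := 1))).const_mul (1 / 2)
  have hle : ∀ t, g t * lowWeight θ r t ≤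
      g t + 2 * θ * (g t * Set.indicator (Set.Icc (-r) r) (fun _ => 1) t) -
        1 / 2 * (g t * Set.indicator (Set.Icc (-1) 1) (fun _ => 1) t) := by
    intro t
    have := mul_le_mul_of_nonneg_left (lowWeight_le hθ.le hθ1 hr t) (hg0 t)
    linarith
  have hmeas : Measurable fun t => g t * lowWeight θ r t := by
    have := measurable_lowWeight θ r
    simp only [g]
    fun_prop
  have hlw0 : ∀ t, 0 ≤ g t * lowWeight θ r t := fun t =>
    mul_nonneg (hg0 t) (Real.exp_pos _).le
  have hgl : Integrable fun t => g t * lowWeight θ r t :=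
    ((hg.add i1).sub i2).mono' hmeas.aestronglyMeasurable
      (ae_of_all _ fun t => by
        rw [Real.norm_eq_abs, abs_of_nonneg (hlw0 t)]
        exact hle t)
  have hfinal : ∫ t, g t * lowWeight θ r t ≤ Real.exp (θ * ε / 4) * ∫ t, g t := by
    calc ∫ t, g t * lowWeight θ r t
        ≤ ∫ t, (g t + 2 * θ * (g t * Set.indicator (Set.Icc (-r) r) (fun _ => 1) t) -
            1 / 2 * (g t * Set.indicator (Set.Icc (-1) 1) (fun _ => 1) t)) :=
          integral_mono hgl ((hg.add i1).sub i2) hle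
      _ = J + 2 * θ * Low - 1 / 2 * Con := by
          have e1 := integral_sub (hg.add i1) i2
          simp only [Pi.add_apply] at e1
          rw [e1, integral_add hg i1, integral_const_mul, integral_const_mul, hindI _ measurableSet_Icc, hindI _ measurableSet_Icc, hgJ]
      _ ≤ (1 + θ * ε / 4) * J := by linarith
      _ ≤ _ := by
          rw [hgJ]
          gcongr
          linarith [Real.add_one_le_exp (θ * ε / 4)]
  have hofReal : ∀ t, ENNReal.ofReal (Real.exp (-(a * (t - m) ^ 2))) *
      ENNReal.ofReal (lowWeight θ r t) = ENNReal.ofReal (g t * lowWeight θ r t) := fun t =>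
    (ENNReal.ofReal_mul (hg0 t)).symm
  simp only [hofReal]
  rw [← ofReal_integral_eq_lintegral_ofReal hgl (ae_of_all _ hlw0),
    ← ofReal_integral_eq_lintegral_ofReal hg (ae_of_all _ hg0),
    ← ENNReal.ofReal_mul (Real.exp_nonneg _)]
  exact ENNReal.ofReal_le_ofReal hfinal

end OneSite

/-! ### Square-root moments and annealed bounds for random Gibbs weights -/

section Disorder

open scoped ENNReal

/-- With `w` the square root, `w = 1 + p ξ / 2 - (w - 1)^2 / 2`, and `(w - 1)^2 ≥ p^2 ξ^2 / (2 (2 +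
|ξ|))`. The free parameter `s` linearizes the quotient `ξ^2 / (2 + |ξ|)`, so that only first
absolute moments enter after integration. -/
theorem sqrt_one_add_mul_le {p ξ : ℝ} (s : ℝ) (hp0 : 0 ≤ p) (hp1 : p ≤ 1) (hξ : -1 ≤ ξ) :
    √(1 + p * ξ) ≤ 1 + p * ξ / 2 - 1 / 4 * p ^ 2 * (2 * s * |ξ| - s ^ 2 * (2 + |ξ|)) := by
  have hnn : 0 ≤ 1 + p * ξ := by nlinarith
  set w := √(1 + p * ξ)
  have hw : 0 ≤ w := Real.sqrt_nonneg _
  have hw2 : w ^ 2 = 1 + p * ξ := Real.sq_sqrt hnn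
  set b := |ξ|
  have hb : 0 ≤ b := abs_nonneg ξ
  have hb2 : b ^ 2 = ξ ^ 2 := sq_abs ξ
  have hpb : p * ξ ≤ b := by nlinarith [le_abs_self ξ]
  have h1 : (2 * s * b - s ^ 2 * (2 + b)) * (2 + b) ≤ b ^ 2 := by
    nlinarith [sq_nonneg (b - s * (2 + b))]
  have h2 : (w + 1) ^ 2 ≤ 2 * (2 + b) := by nlinarith [sq_nonneg (w - 1)]
  have h3 : p ^ 2 * b ^ 2 ≤ (w - 1) ^ 2 * (2 * (2 + b)) := by
    have : p ^ 2 * b ^ 2 = (w - 1) ^ 2 * (w + 1) ^ 2 := by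
      rw [hb2, ← mul_pow, ← mul_pow]
      congr 1
      nlinarith
    rw [this]
    gcongr
  have h4 : p ^ 2 * (2 * s * b - s ^ 2 * (2 + b)) ≤ 2 * (w - 1) ^ 2 := by
    have h5 : p ^ 2 * (2 * s * b - s ^ 2 * (2 + b)) * (2 + b) ≤ 2 * (w - 1) ^ 2 * (2 + b) := by
      nlinarith [mul_le_mul_of_nonneg_left h1 (sq_nonneg p)]
    exact le_of_mul_le_mul_right h5 (by linarith)
  nlinarith

/-- A tilt by a non-degenerate mean-one density gains only quadratically in square-root
expectation. -/
theorem exists_integral_sqrt_le {Ω : Type*} [MeasurableSpace Ω] {μ : Measure Ω}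
    [IsProbabilityMeasure μ] {Y : Ω → ℝ} (hY0 : ∀ a, 0 ≤ Y a) (hY : Integrable Y μ)
    (hY1 : ∫ a, Y a ∂μ = 1) (hne : ¬ Y =ᵐ[μ] fun _ => 1) :
    ∃ C : ℝ, 0 < C ∧ ∃ u₀ : ℝ, 0 < u₀ ∧ ∀ u : ℝ, 0 < u → u < u₀ → ∀ p : ℝ, 0 ≤ p → p ≤ 1 →
      ∫⁻ a, ENNReal.ofReal √(1 + p * (Real.exp u * Y a - 1)) ∂μ ≤
        ENNReal.ofReal (Real.exp (C * u ^ 2)) := by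
  set κ := ∫ a, |Y a - 1| ∂μ
  have hint1 : Integrable (fun a => |Y a - 1|) μ := (hY.sub (integrable_const 1)).abs
  have hκ : 0 < κ := by
    refine lt_of_le_of_ne (integral_nonneg fun _ => abs_nonneg _) fun h0 => hne ?_
    have := (integral_eq_zero_iff_of_nonneg (fun _ => abs_nonneg _) hint1).1 h0.symm
    filter_upwards [this] with a ha
    simpa [sub_eq_zero] using ha
  -- The value `24 u^2 / κ^2` is the maximum over `p` of `p u - κ^2 p^2 / 96`; `u ≤ κ / 4` keeps the
  -- mean absolute deviation of the tilted variable above `κ / 2`.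
  refine ⟨24 / κ ^ 2, by positivity, min 1 (κ / 4), by positivity, fun u hu hu0 p hp0 hp1 => ?_⟩
  have hu1 : u ≤ 1 := hu0.le.trans (min_le_left _ _)
  have huκ : u ≤ κ / 4 := hu0.le.trans (min_le_right _ _)
  set v := Real.exp u - 1
  have hv0 : 0 ≤ v := by have := Real.add_one_le_exp u; simp only [v]; linarith
  have hv : v ≤ 2 * u := by
    have h1 := Real.abs_exp_sub_one_le (x := u) (by rw [abs_of_nonneg hu.le]; exact hu1)
    rw [abs_of_nonneg hu.le] at h1
    exact (le_abs_self _).trans h1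
  have hev : Real.exp u = 1 + v := by simp [v]
  set ξ : Ω → ℝ := fun a => Real.exp u * Y a - 1
  have hξ : Integrable ξ μ := (hY.const_mul _).sub (integrable_const 1)
  have hξi : ∫ a, ξ a ∂μ = v := by
    simp only [ξ]
    rw [integral_sub (hY.const_mul _) (integrable_const 1), integral_const_mul, hY1]
    simp [v]
  have hξ1 : ∀ a, -1 ≤ ξ a := fun a => by
    have := mul_nonneg (Real.exp_pos u).le (hY0 a)
    simp only [ξ]; linarith
  set e := ∫ a, |ξ a| ∂μ
  have he1 : κ / 2 ≤ e := by
    have h1 : κ - v ≤ e := by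
      have h2 : ∫ a, (|Y a - 1| - v * Y a) ∂μ ≤ e := by
        refine integral_mono (hint1.sub (hY.const_mul v)) hξ.abs fun a => ?_
        have h3 : Y a - 1 = ξ a - v * Y a := by simp only [ξ, hev]; ring
        have h4 : |Y a - 1| ≤ |ξ a| + |v * Y a| := by rw [h3]; exact abs_sub _ _
        rw [abs_of_nonneg (mul_nonneg hv0 (hY0 a))] at h4
        simp only
        linarith
      rw [integral_sub hint1 (hY.const_mul v), integral_const_mul, hY1] at h2
      linarith
    linarith
  have he2 : e ≤ 4 := by
    have h2 : e ≤ ∫ a, (Real.exp u * Y a + 1) ∂μ := by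
      refine integral_mono hξ.abs ((hY.const_mul _).add (integrable_const 1)) fun a => ?_
      have := mul_nonneg (Real.exp_pos u).le (hY0 a)
      simp only [ξ]
      rw [abs_le]
      constructor <;> linarith
    rw [integral_add (hY.const_mul _) (integrable_const 1), integral_const_mul, hY1] at h2
    simp at h2
    linarith
  set s := κ / 12
  have hbd : Integrable
      (fun a => 1 + p * ξ a / 2 - 1 / 4 * p ^ 2 * (2 * s * |ξ a| - s ^ 2 * (2 + |ξ a|))) μ := by
    have := hξ.abs
    fun_prop
  have hsqrt0 : ∀ a, 0 ≤ √(1 + p * ξ a) := fun a => Real.sqrt_nonneg _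
  have hle : ∀ a, √(1 + p * ξ a) ≤
      1 + p * ξ a / 2 - 1 / 4 * p ^ 2 * (2 * s * |ξ a| - s ^ 2 * (2 + |ξ a|)) := fun a =>
    sqrt_one_add_mul_le s hp0 hp1 (hξ1 a)
  have hsum : ∫ a, (1 + p * ξ a / 2 - 1 / 4 * p ^ 2 * (2 * s * |ξ a| - s ^ 2 * (2 + |ξ a|))) ∂μ =
      1 + p * v / 2 - 1 / 4 * p ^ 2 * (2 * s * e - s ^ 2 * (2 + e)) := by
    have hpt : ∀ a, 1 + p * ξ a / 2 - 1 / 4 * p ^ 2 * (2 * s * |ξ a| - s ^ 2 * (2 + |ξ a|)) =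
        (1 + 1 / 2 * p ^ 2 * s ^ 2) + (p / 2 * ξ a - 1 / 4 * p ^ 2 * (2 * s - s ^ 2) * |ξ a|) :=
      fun a => by ring
    simp only [hpt]
    have i1 : Integrable (fun a => p / 2 * ξ a) μ := hξ.const_mul _
    have i2 : Integrable (fun a => 1 / 4 * p ^ 2 * (2 * s - s ^ 2) * |ξ a|) μ :=
      hξ.abs.const_mul _
    have i3 : Integrable
        (fun a => p / 2 * ξ a - 1 / 4 * p ^ 2 * (2 * s - s ^ 2) * |ξ a|) μ := i1.sub i2
    rw [integral_add (integrable_const _) i3, integral_sub i1 i2, integral_const_mul,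
      integral_const_mul, hξi, integral_const, probReal_univ, one_smul]
    ring
  refine (lintegral_mono fun a => ENNReal.ofReal_le_ofReal (hle a)).trans ?_
  rw [← ofReal_integral_eq_lintegral_ofReal hbd
    (ae_of_all _ fun a => (hsqrt0 a).trans (hle a)), hsum]
  refine ENNReal.ofReal_le_ofReal ?_
  have h1 : κ ^ 2 / 24 ≤ 2 * s * e - s ^ 2 * (2 + e) := by
    simp only [s]
    nlinarith [mul_le_mul_of_nonneg_left he1 hκ.le, mul_le_mul_of_nonneg_left he2 (sq_nonneg κ)]
  have h2 : p * u - κ ^ 2 / 96 * p ^ 2 ≤ 24 / κ ^ 2 * u ^ 2 := by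
    rw [div_mul_eq_mul_div 24, le_div_iff₀ (by positivity)]
    nlinarith [sq_nonneg (κ ^ 2 * p - 48 * u)]
  have h3 := Real.add_one_le_exp (24 / κ ^ 2 * u ^ 2)
  nlinarith [mul_le_mul_of_nonneg_left h1 (sq_nonneg p), mul_le_mul_of_nonneg_left hv hp0]

/-- Dividing by `A + B` reduces to `p = B / (A + B)`, the contact probability at the site being
integrated out. The degenerate totals zero and infinity are treated apart. -/
theorem lintegral_rpow_add_mul_le {Ω : Type*} [MeasurableSpace Ω] {μ : Measure Ω}
    {Y : Ω → ℝ} (hY0 : ∀ a, 0 ≤ Y a) {c : ℝ≥0∞} (hc : 1 ≤ c) {u : ℝ}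
    (hbound : ∀ p : ℝ, 0 ≤ p → p ≤ 1 →
      ∫⁻ a, ENNReal.ofReal √(1 + p * (Real.exp u * Y a - 1)) ∂μ ≤ c) (A B : ℝ≥0∞) :
    ∫⁻ a, (A + ENNReal.ofReal (Real.exp u * Y a) * B) ^ (1 / 2 : ℝ) ∂μ ≤
      c * (A + B) ^ (1 / 2 : ℝ) := by
  by_cases htop : A + B = ∞
  · rw [htop, ENNReal.top_rpow_of_pos (by norm_num),
      ENNReal.mul_top (by rintro rfl; simp at hc)]
    exact le_top
  obtain ⟨hA, hB⟩ := ENNReal.add_ne_top.1 htop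
  by_cases hzero : A + B = 0
  · obtain ⟨rfl, rfl⟩ := add_eq_zero.1 hzero
    simp
  set A' := A.toReal
  set B' := B.toReal
  have hA' : A = ENNReal.ofReal A' := (ENNReal.ofReal_toReal hA).symm
  have hB' : B = ENNReal.ofReal B' := (ENNReal.ofReal_toReal hB).symm
  have hA0 : 0 ≤ A' := ENNReal.toReal_nonneg
  have hB0 : 0 ≤ B' := ENNReal.toReal_nonneg
  have hsum : A + B = ENNReal.ofReal (A' + B') := by rw [ENNReal.ofReal_add hA0 hB0, ← hA', ← hB']
  have hpos : 0 < A' + B' := by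
    rw [hsum] at hzero
    exact ENNReal.ofReal_pos.1 (pos_iff_ne_zero.2 hzero)
  have hpt : ∀ a, (A + ENNReal.ofReal (Real.exp u * Y a) * B) ^ (1 / 2 : ℝ) =
      ENNReal.ofReal √(1 + B' / (A' + B') * (Real.exp u * Y a - 1)) *
        (A + B) ^ (1 / 2 : ℝ) := by
    intro a
    have h1 : 0 ≤ Real.exp u * Y a := mul_nonneg (Real.exp_pos u).le (hY0 a)
    have h2 : A' + Real.exp u * Y a * B' =
        (1 + B' / (A' + B') * (Real.exp u * Y a - 1)) * (A' + B') := by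
      field_simp
      ring
    have h3 : 0 ≤ 1 + B' / (A' + B') * (Real.exp u * Y a - 1) := by
      have : 1 + B' / (A' + B') * (Real.exp u * Y a - 1) =
          (A' + Real.exp u * Y a * B') / (A' + B') := by
        field_simp
        ring
      rw [this]
      positivity
    rw [hsum]
    nth_rewrite 1 [hA', hB']
    rw [← ENNReal.ofReal_mul h1, ← ENNReal.ofReal_add hA0 (by positivity), h2,
      ENNReal.ofReal_mul h3, ENNReal.mul_rpow_of_nonneg _ _ (by norm_num), Real.sqrt_eq_rpow,
      ENNReal.ofReal_rpow_of_nonneg h3 (by norm_num)]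
  simp only [hpt]
  rw [lintegral_mul_const' _ _ (ENNReal.rpow_ne_top_of_nonneg (by norm_num) htop)]
  gcongr
  exact hbound _ (by positivity) (div_le_one_of_le₀ (by linarith) hpos.le)

section SiteWeight

variable {I X : Type*} {δ : I → X → ℝ}

/-- The Gibbs weight of the contacts at the sites of `S`, a contact at `x` having weight
`exp (β w x - l + u)`. -/
def siteWeight (δ : I → X → ℝ) (β l u : ℝ) (S : Finset I) (w : I → ℝ) (φ : X) : ℝ≥0∞ :=
  ∏ x ∈ S, ENNReal.ofReal (Real.exp ((β * w x - l + u) * δ x φ))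

theorem measurable_siteWeight [MeasurableSpace X] (hδm : ∀ x, Measurable (δ x)) (β l u : ℝ) (S : Finset I) :
    Measurable fun q : (I → ℝ) × X => siteWeight δ β l u S q.1 q.2 := by
  unfold siteWeight
  fun_prop

theorem measurable_siteWeight_right [MeasurableSpace X] (hδm : ∀ x, Measurable (δ x)) (β l u : ℝ) (S : Finset I)
    (w : I → ℝ) : Measurable fun φ => siteWeight δ β l u S w φ := by
  unfold siteWeight
  fun_prop

theorem siteWeight_insert_update [DecidableEq I] {β l u : ℝ} {S : Finset I} {x : I} (hx : x ∉ S) (w : I → ℝ)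
    (t : ℝ) (φ : X) :
    siteWeight δ β l u (insert x S) (Function.update w x t) φ =
      ENNReal.ofReal (Real.exp ((β * t - l + u) * δ x φ)) * siteWeight δ β l u S w φ := by
  rw [siteWeight, siteWeight, Finset.prod_insert hx, Function.update_self]
  congr 1
  refine Finset.prod_congr rfl fun y hy => ?_
  rw [Function.update_of_ne]
  rintro rfl
  exact hx hy

theorem siteWeight_update [DecidableEq I] {β l u : ℝ} {S : Finset I} {x : I} (hx : x ∉ S) (w : I → ℝ)
    (t : ℝ) (φ : X) :
    siteWeight δ β l u S (Function.update w x t) φ = siteWeight δ β l u S w φ := by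
  refine Finset.prod_congr rfl fun y hy => ?_
  rw [Function.update_of_ne]
  rintro rfl
  exact hx hy

theorem lintegral_siteWeight_insert [DecidableEq I] [MeasurableSpace X] {P : Measure X}
    (hδm : ∀ x, Measurable (δ x))
    (hδ : ∀ x φ, δ x φ = 0 ∨ δ x φ = 1) {β l u : ℝ} {S : Finset I} {x : I} (hx : x ∉ S)
    (w : I → ℝ) (t : ℝ) :
    ∫⁻ φ, siteWeight δ β l u (insert x S) (Function.update w x t) φ ∂P =
      ∫⁻ φ in (δ x ⁻¹' {1})ᶜ, siteWeight δ β l u S w φ ∂P +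
        ENNReal.ofReal (Real.exp u * Real.exp (β * t - l)) *
          ∫⁻ φ in δ x ⁻¹' {1}, siteWeight δ β l u S w φ ∂P := by
  have hE : MeasurableSet (δ x ⁻¹' {1}) := hδm x (measurableSet_singleton 1)
  have hm := measurable_siteWeight_right hδm β l u S w
  simp only [siteWeight_insert_update hx]
  rw [← lintegral_add_compl _ hE, add_comm, ← lintegral_const_mul _ hm]
  congr 1
  · refine setLIntegral_congr_fun hE.compl fun φ hφ => ?_
    have h0 : δ x φ = 0 := (hδ x φ).resolve_right (by simpa using hφ)
    simp [h0]
  · refine setLIntegral_congr_fun hE fun φ hφ => ?_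
    have h1 : δ x φ = 1 := by simpa using hφ
    simp only [h1, mul_one]
    rw [← Real.exp_add, add_comm u]

end SiteWeight

/-- Under the tilted measure, an event either comes with few contacts, or is controlled by the
square root of the partition function with doubled pinning `h`. -/
theorem tilted_apply_le {I X : Type*} [Fintype I] [MeasurableSpace X] {P : Measure X}
    [IsProbabilityMeasure P] {δ : I → X → ℝ} (hδm : ∀ x, Measurable (δ x)) (hδ : ∀ x φ, δ x φ = 0 ∨ δ x φ = 1)
    {β l h m : ℝ} (hh : 0 ≤ h) {q : ℝ≥0∞} (hq : q ≤ P {φ | ∀ x, δ x φ = 0}) (w : I → ℝ) {A : Set X}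
    (hA : MeasurableSet A) :
    P.tilted (fun φ => ∑ x, (β * w x - l + h) * δ x φ) A ≤
      q⁻¹ * ∫⁻ φ in A ∩ {φ | ∑ x, δ x φ < m}, siteWeight δ β l h Finset.univ w φ ∂P +
        q⁻¹ ^ (1 / 2 : ℝ) * ENNReal.ofReal (Real.exp (-(h * m / 2))) *
          (∫⁻ φ, siteWeight δ β l (2 * h) Finset.univ w φ ∂P) ^ (1 / 2 : ℝ) := by
  set f : X → ℝ := fun φ => ∑ x, (β * w x - l + h) * δ x φ
  have hf : Measurable f := by fun_prop
  have hLm : Measurable fun φ => ∑ x, δ x φ := by fun_prop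
  have hW := fun u => measurable_siteWeight_right hδm β l u Finset.univ w
  have hWf : ∀ φ, siteWeight δ β l h Finset.univ w φ = ENNReal.ofReal (Real.exp (f φ)) := by
    intro φ
    rw [Real.exp_sum, ENNReal.ofReal_prod_of_nonneg fun _ _ => (Real.exp_pos _).le, siteWeight]
  have hint : Integrable (fun φ => Real.exp (f φ)) P := by
    refine Integrable.of_bound (C := Real.exp (∑ x, |β * w x - l + h|))
      (by fun_prop) (ae_of_all _ fun φ => ?_)
    rw [Real.norm_eq_abs, abs_of_pos (Real.exp_pos _), Real.exp_le_exp]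
    refine Finset.sum_le_sum fun x _ => ?_
    rcases hδ x φ with h0 | h1
    · simp [h0]
    · rw [h1, mul_one]; exact le_abs_self _
  have hprob : IsProbabilityMeasure (P.tilted f) := isProbabilityMeasure_tilted hint
  set Z := ∫⁻ φ, siteWeight δ β l h Finset.univ w φ ∂P
  have hZ : Z = ENNReal.ofReal (∫ φ, Real.exp (f φ) ∂P) := by
    rw [ofReal_integral_eq_lintegral_ofReal hint (ae_of_all _ fun _ => (Real.exp_pos _).le)]
    exact lintegral_congr hWf
  have hIpos : 0 < ∫ φ, Real.exp (f φ) ∂P := integral_exp_pos hint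
  -- Configurations without contact have weight one, whatever the environment.
  have hqZ : q ≤ Z := by
    refine hq.trans ?_
    have hG : MeasurableSet {φ | ∀ x, δ x φ = 0} := by
      simp only [Set.ofPred_forall]
      exact MeasurableSet.iInter fun x => measurableSet_eq_fun (hδm x) measurable_const
    rw [← lintegral_indicator_one hG]
    refine lintegral_mono fun φ => ?_
    by_cases hφ : φ ∈ {φ | ∀ x, δ x φ = 0}
    · have h0 : ∀ x, δ x φ = 0 := by simpa using hφ
      rw [Set.indicator_of_mem hφ]
      simp [siteWeight, h0]
    · rw [Set.indicator_of_notMem hφ]; exact zero_le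
  have happ : ∀ s : Set X, MeasurableSet s →
      P.tilted f s = Z⁻¹ * ∫⁻ φ in s, siteWeight δ β l h Finset.univ w φ ∂P := by
    intro s hs
    rw [tilted_apply' _ _ hs, ← lintegral_const_mul _ (hW h)]
    refine setLIntegral_congr_fun hs fun φ _ => ?_
    rw [hWf, hZ, ENNReal.ofReal_div_of_pos hIpos, ENNReal.div_eq_inv_mul]
  have hLs : MeasurableSet {φ | ∑ x, δ x φ < m} := measurableSet_lt hLm measurable_const
  have hLs' : MeasurableSet {φ | m ≤ ∑ x, δ x φ} := measurableSet_le measurable_const hLm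
  have hsplit : A ⊆ (A ∩ {φ | ∑ x, δ x φ < m}) ∪ {φ | m ≤ ∑ x, δ x φ} := by
    intro φ hφ
    rcases lt_or_ge (∑ x, δ x φ) m with h1 | h1
    · exact Or.inl ⟨hφ, h1⟩
    · exact Or.inr h1
  refine (measure_mono hsplit).trans ((measure_union_le _ _).trans (add_le_add ?_ ?_))
  · rw [happ _ (hA.inter hLs)]
    gcongr
  · have hbig : P.tilted f {φ | m ≤ ∑ x, δ x φ} ≤ q⁻¹ * (ENNReal.ofReal (Real.exp (-(h * m))) *
        ∫⁻ φ, siteWeight δ β l (2 * h) Finset.univ w φ ∂P) := by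
      rw [happ _ hLs', ← lintegral_const_mul _ (hW (2 * h))]
      refine mul_le_mul' (ENNReal.inv_le_inv.2 hqZ) ?_
      refine (setLIntegral_mono' hLs' fun φ hφ => ?_).trans (setLIntegral_le_lintegral _ _)
      rw [siteWeight, siteWeight, ← ENNReal.ofReal_prod_of_nonneg fun _ _ => (Real.exp_pos _).le,
        ← ENNReal.ofReal_prod_of_nonneg fun _ _ => (Real.exp_pos _).le, ← Real.exp_sum,
        ← Real.exp_sum, ← ENNReal.ofReal_mul (Real.exp_pos _).le, ← Real.exp_add]
      refine ENNReal.ofReal_le_ofReal (Real.exp_le_exp.2 ?_)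
      have h1 : ∑ x, (β * w x - l + 2 * h) * δ x φ =
          ∑ x, (β * w x - l + h) * δ x φ + h * ∑ x, δ x φ := by
        rw [Finset.mul_sum, ← Finset.sum_add_distrib]
        exact Finset.sum_congr rfl fun x _ => by ring
      have h2 : m ≤ ∑ x, δ x φ := by simpa using hφ
      rw [h1]
      nlinarith
    have hle1 : P.tilted f {φ | m ≤ ∑ x, δ x φ} ≤ 1 := prob_le_one
    set T := P.tilted f {φ | m ≤ ∑ x, δ x φ}
    -- A probability is at most its square root; this replaces the mean of the partition function,
    -- too large here, by its square-root moment.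
    calc T ≤ T ^ (1 / 2 : ℝ) := by
          conv_lhs => rw [← ENNReal.rpow_one T]
          exact ENNReal.rpow_le_rpow_of_exponent_ge hle1 (by norm_num)
      _ ≤ (q⁻¹ * (ENNReal.ofReal (Real.exp (-(h * m))) *
            ∫⁻ φ, siteWeight δ β l (2 * h) Finset.univ w φ ∂P)) ^ (1 / 2 : ℝ) := by gcongr
      _ = _ := by
          rw [ENNReal.mul_rpow_of_nonneg _ _ (by norm_num),
            ENNReal.mul_rpow_of_nonneg _ _ (by norm_num),
            ENNReal.ofReal_rpow_of_nonneg (Real.exp_pos _).le (by norm_num), ← Real.exp_mul,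
            mul_assoc]
          congr 4
          ring

variable {I : Type*} [Fintype I] [DecidableEq I] {ν : Measure ℝ} [IsProbabilityMeasure ν]

theorem lintegral_pi_prod_le {C : I → ℝ≥0∞} {g : I → ℝ → ℝ≥0∞} (hg : ∀ x, Measurable (g x))
    (hC : ∀ x, ∫⁻ t, g x t ∂ν ≤ C x) (S : Finset I) :
    ∫⁻ w, ∏ x ∈ S, g x (w x) ∂(Measure.pi fun _ : I => ν) ≤ ∏ x ∈ S, C x := by
  induction S using Finset.induction_on with
  | empty => simp
  | insert x S hx ih =>
    rw [Finset.prod_insert hx]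
    refine le_trans ?_ (mul_le_mul_right ih (C x))
    rw [← lintegral_const_mul _ (by fun_prop)]
    refine lintegral_le_of_lmarginal_le {x} (by fun_prop) (by fun_prop) ?_
    rw [lmarginal_singleton, lmarginal_singleton]
    intro w
    have hupd : ∀ t, ∏ y ∈ S, g y (Function.update w x t y) = ∏ y ∈ S, g y (w y) := fun t =>
      Finset.prod_congr rfl fun y hy => by
        rw [Function.update_of_ne]
        rintro rfl
        exact hx hy
    simp only [Finset.prod_insert hx, hupd, Function.update_self]
    rw [lintegral_mul_const _ (hg x), lintegral_const, measure_univ, mul_one]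
    gcongr
    exact hC x


variable {X : Type*} [MeasurableSpace X] {P : Measure X} [IsProbabilityMeasure P]
  {δ : I → X → ℝ}

/-- As a function of the disorder at one site, the partition function is affine in `exp(β t - l)`,
with coefficients depending on the other sites only. Integrating out that site costs a factor `c`
and removes its weight entirely. -/
theorem lintegral_rpow_siteWeight_le (hδm : ∀ x, Measurable (δ x))
    (hδ : ∀ x φ, δ x φ = 0 ∨ δ x φ = 1) {β l u : ℝ} {c : ℝ≥0∞} (hc : 1 ≤ c)
    (hbound : ∀ p : ℝ, 0 ≤ p → p ≤ 1 →
      ∫⁻ t, ENNReal.ofReal √(1 + p * (Real.exp u * Real.exp (β * t - l) - 1)) ∂ν ≤ c)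
    (S : Finset I) :
    ∫⁻ w, (∫⁻ φ, siteWeight δ β l u S w φ ∂P) ^ (1 / 2 : ℝ) ∂(Measure.pi fun _ : I => ν) ≤
      c ^ S.card := by
  have hmeas : ∀ S : Finset I, Measurable fun w : I → ℝ =>
      (∫⁻ φ, siteWeight δ β l u S w φ ∂P) ^ (1 / 2 : ℝ) := fun S =>
    (Measurable.lintegral_prod_right' (measurable_siteWeight hδm β l u S)).pow_const _
  induction S using Finset.induction_on with
  | empty => simp [siteWeight]
  | insert x S hx ih =>
    rw [Finset.card_insert_of_notMem hx, pow_succ']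
    refine le_trans ?_ (mul_le_mul_right ih c)
    rw [← lintegral_const_mul _ (hmeas S)]
    refine lintegral_le_of_lmarginal_le {x} (hmeas _) ((hmeas S).const_mul c) ?_
    rw [lmarginal_singleton, lmarginal_singleton]
    intro w
    have hE : MeasurableSet (δ x ⁻¹' {1}) := hδm x (measurableSet_singleton 1)
    simp only [lintegral_siteWeight_insert hδm hδ hx, siteWeight_update hx]
    rw [lintegral_const, measure_univ, mul_one, ← lintegral_add_compl (μ := P) (siteWeight δ β l u S w) hE,
      add_comm (∫⁻ φ in δ x ⁻¹' {1}, siteWeight δ β l u S w φ ∂P)]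
    exact lintegral_rpow_add_mul_le (fun t => (Real.exp_pos _).le) hc hbound _ _

/-- Tonelli and independence: for a fixed field, the mean-one normalization leaves at most `exp u`
per contact. -/
theorem lintegral_lintegral_siteWeight_le (hδm : ∀ x, Measurable (δ x))
    (hδ : ∀ x φ, δ x φ = 0 ∨ δ x φ = 1) {β l u : ℝ}
    (hone : ∫⁻ t, ENNReal.ofReal (Real.exp (β * t - l)) ∂ν ≤ 1) (s : Set X) :
    ∫⁻ w, ∫⁻ φ in s, siteWeight δ β l u Finset.univ w φ ∂P ∂(Measure.pi fun _ : I => ν) ≤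
      ∫⁻ φ in s, ENNReal.ofReal (Real.exp (u * ∑ x, δ x φ)) ∂P := by
  rw [lintegral_lintegral_swap (measurable_siteWeight hδm β l u Finset.univ).aemeasurable]
  refine lintegral_mono fun φ => ?_
  rw [Finset.mul_sum, Real.exp_sum, ENNReal.ofReal_prod_of_nonneg fun _ _ => (Real.exp_pos _).le]
  refine lintegral_pi_prod_le (g := fun x t =>
    ENNReal.ofReal (Real.exp ((β * t - l + u) * δ x φ))) (fun x => by fun_prop) (fun x => ?_) _
  rcases hδ x φ with h0 | h1
  · simp [h0]
  · simp only [h1, mul_one]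
    calc ∫⁻ t, ENNReal.ofReal (Real.exp (β * t - l + u)) ∂ν
        = ∫⁻ t, ENNReal.ofReal (Real.exp (β * t - l)) * ENNReal.ofReal (Real.exp u) ∂ν := by
          refine lintegral_congr fun t => ?_
          rw [← ENNReal.ofReal_mul (Real.exp_pos _).le, ← Real.exp_add]
      _ = (∫⁻ t, ENNReal.ofReal (Real.exp (β * t - l)) ∂ν) * ENNReal.ofReal (Real.exp u) :=
          lintegral_mul_const _ (by fun_prop)
      _ ≤ 1 * ENNReal.ofReal (Real.exp u) := by gcongr
      _ = _ := one_mul _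

end Disorder

/-! ### The pinned field in a box -/

section Box

open scoped ENNReal

variable {d : ℕ} {N : ℕ}

/-- Used to drop the sites of `{1, …, N}^d` outside the interior: the field vanishes there, so their
pinning terms are constants cancelled by normalization. -/
theorem tilted_add_const_right {X : Type*} [MeasurableSpace X] (P : Measure X) (f : X → ℝ)
    (c : ℝ) : P.tilted (fun x => f x + c) = P.tilted f := by
  have : ∀ x, Real.exp (f x + c) / ∫ y, Real.exp (f y + c) ∂P =
      Real.exp (f x) / ∫ y, Real.exp (f y) ∂P := by
    intro x
    simp only [Real.exp_add]
    rw [integral_mul_const, mul_div_mul_right _ _ (Real.exp_pos c).ne']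
  simp only [Measure.tilted, this]

theorem freeField_zero_eq (Λ : Finset (Site d)) :
    freeField Λ (fun _ => 0) = gaussMeasure (dirichlet Λ) := by
  rw [freeField, gaussMeasure]
  simp only [energy_glue]

theorem sum_tildeBox_glue (F : Site d → ℝ → ℝ) (φ : interiorPts (box d N) → ℝ) :
    ∑ x ∈ tildeBox d N, F x (glue (box d N) (fun _ => 0) φ x) =
      ∑ x : interiorPts (box d N), F x (φ x) +
        ∑ x ∈ tildeBox d N \ interiorPts (box d N), F x 0 := by
  rw [← Finset.sum_sdiff (interiorPts_subset_tildeBox N), add_comm]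
  congr 1
  · rw [← Finset.sum_coe_sort]
    exact Finset.sum_congr rfl fun x _ => by rw [glue_of_mem]
  · refine Finset.sum_congr rfl fun x hx => ?_
    rw [glue_of_notMem _ _ _ (Finset.mem_sdiff.1 hx).2]

theorem pinned_zero_eq (β l h : ℝ) (w : Site d → ℝ) :
    pinned d N (fun _ => 0) β l h w =
      (gaussMeasure (dirichlet (box d N))).tilted fun φ =>
        ∑ x : interiorPts (box d N), (β * w x - l + h) * contact (φ x) := by
  rw [pinned, freeField_zero_eq]
  simp only [sum_tildeBox_glue (fun x t => (β * w x - l + h) * contact t)]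
  rw [tilted_add_const_right]

theorem contact_eq_zero_or_one (t : ℝ) : contact t = 0 ∨ contact t = 1 := by
  rw [contact]
  by_cases ht : t ∈ Set.Icc (-1 : ℝ) 1
  · right; rw [Set.indicator_of_mem ht]
  · left; rw [Set.indicator_of_notMem ht]

/-- The number of interior sites where the field is at most `r` in absolute value. -/
def lowSum {I : Type*} [Fintype I] (r : ℝ) (φ : I → ℝ) : ℝ :=
  ∑ x, Set.indicator (Set.Icc (-r) r) (fun _ => 1) (φ x)

theorem measurable_lowSum {I : Type*} [Fintype I] (r : ℝ) :
    Measurable (lowSum r : (I → ℝ) → ℝ) := by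
  have : Measurable (Set.indicator (Set.Icc (-r) r) fun _ : ℝ => (1 : ℝ)) :=
    measurable_const.indicator measurableSet_Icc
  unfold lowSum
  fun_prop

theorem lowCount_le (r : ℝ) (φ : interiorPts (box d N) → ℝ) :
    (lowCount d N r (glue (box d N) (fun _ => 0) φ) : ℝ) ≤
      lowSum r φ + ((N : ℝ) ^ d - ((N - 1 : ℕ) : ℝ) ^ d) := by
  have h1 : (lowCount d N r (glue (box d N) (fun _ => 0) φ) : ℝ) =
      ∑ x ∈ tildeBox d N, Set.indicator (Set.Icc (-r) r) (fun _ => (1 : ℝ))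
        (glue (box d N) (fun _ => 0) φ x) := by
    rw [lowCount, Finset.card_filter]
    push_cast
    refine Finset.sum_congr rfl fun x _ => ?_
    simp only [Set.indicator, Set.mem_Icc, abs_le]
  rw [h1, sum_tildeBox_glue (fun _ t => Set.indicator (Set.Icc (-r) r) (fun _ => (1 : ℝ)) t)]
  refine add_le_add le_rfl ?_
  calc ∑ x ∈ tildeBox d N \ interiorPts (box d N),
        Set.indicator (Set.Icc (-r) r) (fun _ => (1 : ℝ)) 0
      ≤ ∑ x ∈ tildeBox d N \ interiorPts (box d N), (1 : ℝ) := by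
        refine Finset.sum_le_sum fun x _ => ?_
        exact Set.indicator_le_self' (fun _ _ => zero_le_one) _
    _ = _ := by
        have h2 := Finset.card_sdiff_add_card_eq_card (interiorPts_subset_tildeBox (d := d) N)
        rw [card_tildeBox, card_interiorPts_box] at h2
        rw [Finset.sum_const, nsmul_eq_mul, mul_one, eq_sub_iff_add_eq]
        exact_mod_cast h2

/-- Bernoulli's inequality: the boundary layer is a vanishing fraction of the box. -/
theorem pow_sub_pow_pred_le {ε : ℝ} (hN : 1 ≤ N) (hN' : (d : ℝ) ≤ ε * N) :
    (N : ℝ) ^ d - ((N - 1 : ℕ) : ℝ) ^ d ≤ ε * (N : ℝ) ^ d := by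
  have hNpos : (0 : ℝ) < N := by exact_mod_cast hN
  have h1 : (1 : ℝ) ≤ N := by exact_mod_cast hN
  have h2 : (-2 : ℝ) ≤ -(1 / N) := by
    rw [neg_le_neg_iff, div_le_iff₀ hNpos]
    linarith
  have h3 := one_add_mul_le_pow h2 d
  have h4 : (((N - 1 : ℕ) : ℝ)) = N * (1 + -(1 / (N : ℝ))) := by
    rw [Nat.cast_sub hN]
    field_simp
    push_cast
    ring
  have h5 : (d : ℝ) * (1 / N) ≤ ε := by
    rw [mul_one_div, div_le_iff₀ hNpos]
    exact hN'
  rw [h4, mul_pow]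
  have h6 : (0 : ℝ) < (N : ℝ) ^ d := by positivity
  nlinarith

variable [NeZero d]

theorem isProbabilityMeasure_box :
    IsProbabilityMeasure (gaussMeasure (dirichlet (box d N))) :=
  isProbabilityMeasure_gaussMeasure (continuous_dirichlet_self _)
    (k := fun x => (bdist N (x : Site d) : ℝ))
    (fun x => by exact_mod_cast bdist_pos x.2) (sq_le_bdist_mul_dirichlet N)

/-- The free field stays above `1` in the whole box at a sub-volume cost. -/
theorem eventually_le_gaussMeasure_one_lt {ρ : ℝ} (hρ : 0 < ρ) :
    ∀ᶠ N : ℕ in atTop, ENNReal.ofReal (Real.exp (-(ρ * (N : ℝ) ^ d))) ≤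
      gaussMeasure (dirichlet (box d N)) {φ | ∀ x, 1 < φ x} := by
  set c₁ : ℝ := 16 * 2 * d ^ 2 * 2 ^ (d - 1)
  have hlittle : (fun x : ℝ => c₁ * (Real.log 4 + d * Real.log x) * (1 + Real.log x) + Real.log 2)
      =o[atTop] (id : ℝ → ℝ) := by
    have e1 := (Real.isLittleO_pow_log_id_atTop (n := 2)).const_mul_left (c₁ * d)
    have e2 := Real.isLittleO_log_id_atTop.const_mul_left (c₁ * (Real.log 4 + d))
    have e3 := Asymptotics.isLittleO_const_id_atTop (c₁ * Real.log 4 + Real.log 2)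
    refine ((e1.add e2).add e3).congr_left fun x => ?_
    ring
  have hev' : ∀ᶠ N : ℕ in atTop,
      c₁ * (Real.log 4 + d * Real.log N) * (1 + Real.log N) + Real.log 2 ≤ ρ * N := by
    filter_upwards [tendsto_natCast_atTop_atTop.eventually (hlittle.bound hρ)] with N hN
    refine (le_abs_self _).trans (hN.trans (le_of_eq ?_))
    simp
  filter_upwards [hev', eventually_ge_atTop 1] with N hN hN1
  have hN1' : (1 : ℝ) ≤ N := by exact_mod_cast hN1
  have hlogN : 0 ≤ Real.log N := Real.log_nonneg hN1'
  have hlog4 : 1 ≤ Real.log 4 := by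
    rw [Real.le_log_iff_exp_le (by norm_num)]
    linarith [Real.exp_one_lt_d9]
  -- Chosen so that `exp(K / 16) = 4 N^d`, which closes the union bound over the sites.
  set K := 16 * (Real.log 4 + d * Real.log N)
  have hK : 4 ≤ K := by
    have : 0 ≤ (d : ℝ) * Real.log N := by positivity
    simp only [K]; linarith
  have hexpK : Real.exp (K / 16) = 4 * (N : ℝ) ^ d := by
    have : K / 16 = Real.log (4 * (N : ℝ) ^ d) := by
      rw [Real.log_mul (by norm_num) (by positivity), Real.log_pow]
      simp only [K]; ring
    rw [this, Real.exp_log (by positivity)]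
  have hcard : 4 * (Fintype.card (interiorPts (box d N)) : ℝ) ≤ Real.exp (K / 16) := by
    rw [hexpK, Fintype.card_coe, card_interiorPts_box]
    gcongr
    push_cast
    gcongr
    simp
  refine le_trans ?_ (gaussMeasure_one_lt_ge (B := dirichlet (box d N)) (dirichlet_comm _)
    (continuous_dirichlet_self _) (k := fun x : interiorPts (box d N) => (bdist N (x : Site d) : ℝ)) (fun x => by exact_mod_cast bdist_pos x.2)
    (sq_le_bdist_mul_dirichlet N) hK hcard)
  refine ENNReal.ofReal_le_ofReal ?_
  have hE := dirichlet_sqrt_bdist_le (d := d) N (by linarith : 0 ≤ K)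
  set E := dirichlet (box d N) (fun x => √(K * bdist N (x : Site d)))
    (fun x => √(K * bdist N (x : Site d)))
  have h2 : Real.exp (-(E / 2)) / 2 = Real.exp (-(E / 2 + Real.log 2)) := by
    rw [neg_add, Real.exp_add, Real.exp_neg (Real.log 2), Real.exp_log (by norm_num)]
    ring
  rw [h2, Real.exp_le_exp, neg_le_neg_iff]
  have hpow : ((N : ℝ) + 1) ^ (d - 1) ≤ 2 ^ (d - 1) * (N : ℝ) ^ (d - 1) := by
    rw [← mul_pow]
    gcongr
    linarith
  have hNd : (N : ℝ) ^ d = N * (N : ℝ) ^ (d - 1) := by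
    rw [← pow_succ', Nat.sub_add_cancel (NeZero.one_le)]
  have hone : 1 ≤ (N : ℝ) ^ (d - 1) := one_le_pow₀ hN1'
  have hlog2 : 0 ≤ Real.log 2 := Real.log_nonneg (by norm_num)
  calc E / 2 + Real.log 2
      ≤ K * (4 * d ^ 2 * (2 ^ (d - 1) * (N : ℝ) ^ (d - 1)) * (1 + Real.log N)) / 2 +
          Real.log 2 * (N : ℝ) ^ (d - 1) := by
        refine add_le_add ?_ (le_mul_of_one_le_right hlog2 hone)
        refine div_le_div_of_nonneg_right (hE.trans ?_) (by norm_num)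
        gcongr
    _ = (c₁ * (Real.log 4 + d * Real.log N) * (1 + Real.log N) + Real.log 2) *
          (N : ℝ) ^ (d - 1) := by
        simp only [K, c₁]; ring
    _ ≤ ρ * N * (N : ℝ) ^ (d - 1) := by gcongr
    _ = ρ * (N : ℝ) ^ d := by rw [hNd]; ring

/-- Many low sites with few contacts are exponentially unlikely for the free field. -/
theorem gaussMeasure_low_few_contacts_le {θ r v k m : ℝ} (hθ : 0 ≤ θ)
    (hv : ∀ b : ℝ, ∫⁻ t, ENNReal.ofReal (Real.exp (-((d : ℝ) * (t - b) ^ 2))) *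
        ENNReal.ofReal (lowWeight θ r t) ≤
      ENNReal.ofReal (Real.exp v) *
        ∫⁻ t, ENNReal.ofReal (Real.exp (-((d : ℝ) * (t - b) ^ 2)))) :
    gaussMeasure (dirichlet (box d N))
        ({φ | k ≤ lowSum r φ} ∩ {φ | ∑ x, contact (φ x) < m}) ≤
      ENNReal.ofReal (Real.exp (m - θ * k + ((N - 1 : ℕ) : ℝ) ^ d * v)) := by
  have hd : (0 : ℝ) < d := by exact_mod_cast NeZero.pos d
  have hbd := lintegral_gaussMeasure_prod_le (B := dirichlet (box d N)) (dirichlet_comm _)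
    (continuous_dirichlet_self _) (k := fun x : interiorPts (box d N) => (bdist N (x : Site d) : ℝ))
    (fun x => by exact_mod_cast bdist_pos x.2) (sq_le_bdist_mul_dirichlet N) hd
    (fun x => by rw [dirichlet_single]) (measurable_lowWeight θ r).ennreal_ofReal hv
  -- Exponential Markov inequality for the reward `θ` times low sites, minus contacts.
  have hsub : {φ : interiorPts (box d N) → ℝ | k ≤ lowSum r φ} ∩ {φ | ∑ x, contact (φ x) < m} ⊆
      {φ | ENNReal.ofReal (Real.exp (θ * k - m)) ≤ ∏ x, ENNReal.ofReal (lowWeight θ r (φ x))} := by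
    rintro φ ⟨h1, h2⟩
    simp only [Set.mem_ofPred_eq] at h1 h2 ⊢
    simp only [lowWeight]
    rw [← ENNReal.ofReal_prod_of_nonneg fun _ _ => (Real.exp_pos _).le]
    refine ENNReal.ofReal_le_ofReal ?_
    rw [← Real.exp_sum, Real.exp_le_exp, Finset.sum_sub_distrib, ← Finset.mul_sum]
    rw [lowSum] at h1
    nlinarith
  have hmeas : Measurable fun φ : interiorPts (box d N) → ℝ =>
      ∏ x, ENNReal.ofReal (lowWeight θ r (φ x)) := by
    have := measurable_lowWeight θ r
    fun_prop
  have hmarkov := mul_meas_ge_le_lintegral (μ := gaussMeasure (dirichlet (box d N))) hmeas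
    (ENNReal.ofReal (Real.exp (θ * k - m)))
  have h3 := (mul_le_mul_right (measure_mono hsub)
    (ENNReal.ofReal (Real.exp (θ * k - m)))).trans (hmarkov.trans hbd)
  rw [Fintype.card_coe, card_interiorPts_box, ← ENNReal.ofReal_pow (Real.exp_pos _).le,
    ← Real.exp_nat_mul] at h3
  have h4 := mul_le_mul_right h3 (ENNReal.ofReal (Real.exp (m - θ * k)))
  rw [← mul_assoc, ← ENNReal.ofReal_mul (Real.exp_pos _).le,
    ← ENNReal.ofReal_mul (Real.exp_pos _).le, ← Real.exp_add, ← Real.exp_add] at h4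
  have h5 : m - θ * k + (θ * k - m) = 0 := by ring
  rw [h5, Real.exp_zero, ENNReal.ofReal_one, one_mul] at h4
  refine h4.trans (le_of_eq ?_)
  push_cast
  rfl

end Box

/-! ### The quenched measure, averaged over the disorder -/

section Quenched

open scoped ENNReal

variable {d : ℕ} [NeZero d] {N : ℕ}

/-- Averaged bound on the pinned probability of having many low sites in a box of fixed size: `m`
separates few from many contacts, and `Q` is the cost of a field without contacts. -/
theorem lintegral_pinned_lowSum_le {Ω : Type*} [MeasurableSpace Ω] {μ : Measure Ω}
    {ω : Site d → Ω → ℝ} (hmeas : ∀ x, Measurable (ω x)) {ν : Measure ℝ} [IsProbabilityMeasure ν]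
    (hω : μ.map (fun a (x : interiorPts (box d N)) => ω x a) = Measure.pi fun _ => ν)
    {β l h C θ r v k m Q : ℝ} (hh : 0 ≤ h) (hC : 0 ≤ C) (hθ : 0 ≤ θ)
    (hone : ∫⁻ t, ENNReal.ofReal (Real.exp (β * t - l)) ∂ν ≤ 1)
    (hsqrt : ∀ p : ℝ, 0 ≤ p → p ≤ 1 →
      ∫⁻ t, ENNReal.ofReal √(1 + p * (Real.exp (2 * h) * Real.exp (β * t - l) - 1)) ∂ν ≤
        ENNReal.ofReal (Real.exp (C * (2 * h) ^ 2)))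
    (hv : ∀ b : ℝ, ∫⁻ t, ENNReal.ofReal (Real.exp (-((d : ℝ) * (t - b) ^ 2))) *
        ENNReal.ofReal (lowWeight θ r t) ≤
      ENNReal.ofReal (Real.exp v) *
        ∫⁻ t, ENNReal.ofReal (Real.exp (-((d : ℝ) * (t - b) ^ 2))))
    (hQ : ENNReal.ofReal (Real.exp (-Q)) ≤
      gaussMeasure (dirichlet (box d N)) {φ | ∀ x, 1 < φ x}) :
    ∫⁻ a, pinned d N (fun _ => 0) β l h (fun x => ω x a) {φ | k ≤ lowSum r φ} ∂μ ≤
      ENNReal.ofReal (Real.exp (Q + h * m + (m - θ * k + ((N - 1 : ℕ) : ℝ) ^ d * v))) +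
        ENNReal.ofReal (Real.exp (Q / 2 - h * m / 2 +
          ((N - 1 : ℕ) : ℝ) ^ d * (C * (2 * h) ^ 2))) := by
  have hP := isProbabilityMeasure_box (d := d) (N := N)
  set P := gaussMeasure (dirichlet (box d N))
  set δ : interiorPts (box d N) → (interiorPts (box d N) → ℝ) → ℝ := fun x φ => contact (φ x)
  have hδm : ∀ x, Measurable (δ x) := fun x => measurable_contact.comp (measurable_pi_apply x)
  have hδ : ∀ x φ, δ x φ = 0 ∨ δ x φ = 1 := fun x φ => contact_eq_zero_or_one _
  set q := ENNReal.ofReal (Real.exp (-Q))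
  have hq : q ≤ P {φ | ∀ x, δ x φ = 0} := by
    refine hQ.trans (measure_mono fun φ hφ => ?_)
    simp only [Set.mem_ofPred_eq] at hφ ⊢
    intro x
    refine Set.indicator_of_notMem (fun hx => ?_) _
    exact absurd hx.2 (not_le.2 (hφ x))
  have hqinv : q⁻¹ = ENNReal.ofReal (Real.exp Q) := by
    rw [← ENNReal.ofReal_inv_of_pos (Real.exp_pos _), Real.exp_neg, inv_inv]
  have hA : MeasurableSet {φ : interiorPts (box d N) → ℝ | k ≤ lowSum r φ} :=
    measurableSet_le measurable_const (measurable_lowSum r)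
  have hLs : MeasurableSet {φ : interiorPts (box d N) → ℝ | ∑ x, δ x φ < m} :=
    measurableSet_lt (by fun_prop) measurable_const
  set A := {φ : interiorPts (box d N) → ℝ | k ≤ lowSum r φ}
  set L := {φ : interiorPts (box d N) → ℝ | ∑ x, δ x φ < m}
  set F : (interiorPts (box d N) → ℝ) → ℝ≥0∞ := fun w =>
    ∫⁻ φ in A ∩ L, siteWeight δ β l h Finset.univ w φ ∂P
  set G : (interiorPts (box d N) → ℝ) → ℝ≥0∞ := fun w =>
    (∫⁻ φ, siteWeight δ β l (2 * h) Finset.univ w φ ∂P) ^ (1 / 2 : ℝ)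
  have hF : Measurable F :=
    Measurable.lintegral_prod_right' (measurable_siteWeight hδm β l h Finset.univ)
  have hG : Measurable G :=
    (Measurable.lintegral_prod_right'
      (measurable_siteWeight hδm β l (2 * h) Finset.univ)).pow_const _
  have hωm : Measurable fun a (x : interiorPts (box d N)) => ω x a :=
    measurable_pi_lambda _ fun x => hmeas x
  have hFint : ∫⁻ w, F w ∂(Measure.pi fun _ => ν) ≤ ENNReal.ofReal (Real.exp (h * m)) *
      ENNReal.ofReal (Real.exp (m - θ * k + ((N - 1 : ℕ) : ℝ) ^ d * v)) := by
    refine (lintegral_lintegral_siteWeight_le hδm hδ hone (A ∩ L)).trans ?_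
    calc ∫⁻ φ in A ∩ L, ENNReal.ofReal (Real.exp (h * ∑ x, δ x φ)) ∂P
        ≤ ∫⁻ _ in A ∩ L, ENNReal.ofReal (Real.exp (h * m)) ∂P := by
          refine setLIntegral_mono' (hA.inter hLs) fun φ hφ => ?_
          refine ENNReal.ofReal_le_ofReal (Real.exp_le_exp.2 ?_)
          have h2 : ∑ x, δ x φ < m := by simpa [L] using hφ.2
          gcongr
      _ = ENNReal.ofReal (Real.exp (h * m)) * P (A ∩ L) := by
          rw [setLIntegral_const]
      _ ≤ _ := by
          gcongr
          exact gaussMeasure_low_few_contacts_le hθ hv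
  have hGint : ∫⁻ w, G w ∂(Measure.pi fun _ => ν) ≤
      ENNReal.ofReal (Real.exp (((N - 1 : ℕ) : ℝ) ^ d * (C * (2 * h) ^ 2))) := by
    have h1 : (1 : ℝ≥0∞) ≤ ENNReal.ofReal (Real.exp (C * (2 * h) ^ 2)) := by
      rw [← ENNReal.ofReal_one]
      exact ENNReal.ofReal_le_ofReal (Real.one_le_exp (by positivity))
    refine (lintegral_rpow_siteWeight_le hδm hδ h1 hsqrt Finset.univ).trans (le_of_eq ?_)
    rw [Finset.card_univ, Fintype.card_coe, card_interiorPts_box,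
      ← ENNReal.ofReal_pow (Real.exp_pos _).le, ← Real.exp_nat_mul]
    push_cast
    rfl
  calc ∫⁻ a, pinned d N (fun _ => 0) β l h (fun x => ω x a) A ∂μ
      ≤ ∫⁻ a, (q⁻¹ * F (fun x => ω x a) + q⁻¹ ^ (1 / 2 : ℝ) *
          ENNReal.ofReal (Real.exp (-(h * m / 2))) * G (fun x => ω x a)) ∂μ := by
        refine lintegral_mono fun a => ?_
        rw [pinned_zero_eq]
        exact tilted_apply_le hδm hδ hh hq _ hA
    _ = ∫⁻ w, (q⁻¹ * F w + q⁻¹ ^ (1 / 2 : ℝ) *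
          ENNReal.ofReal (Real.exp (-(h * m / 2))) * G w) ∂(Measure.pi fun _ => ν) := by
        rw [← hω, lintegral_map (by fun_prop) hωm]
    _ = q⁻¹ * ∫⁻ w, F w ∂(Measure.pi fun _ => ν) + q⁻¹ ^ (1 / 2 : ℝ) *
          ENNReal.ofReal (Real.exp (-(h * m / 2))) * ∫⁻ w, G w ∂(Measure.pi fun _ => ν) := by
        rw [lintegral_add_left (by fun_prop), lintegral_const_mul _ hF, lintegral_const_mul _ hG]
    _ ≤ q⁻¹ * (ENNReal.ofReal (Real.exp (h * m)) *
          ENNReal.ofReal (Real.exp (m - θ * k + ((N - 1 : ℕ) : ℝ) ^ d * v))) +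
        q⁻¹ ^ (1 / 2 : ℝ) * ENNReal.ofReal (Real.exp (-(h * m / 2))) *
          ENNReal.ofReal (Real.exp (((N - 1 : ℕ) : ℝ) ^ d * (C * (2 * h) ^ 2))) := by gcongr
    _ = _ := by
        rw [hqinv, ENNReal.ofReal_rpow_of_nonneg (Real.exp_pos _).le (by norm_num),
          ← Real.exp_mul]
        simp only [← ENNReal.ofReal_mul (Real.exp_pos _).le, ← Real.exp_add]
        congr 3 <;> ring

end Quenched

end PinnedField

end

/-! ### The main theorem: choice of parameters and the limit. -/

open PinnedField in
theorem proposition2p4 (d : ℕ) (hd : 2 ≤ d)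
    {Ω : Type*} [MeasurableSpace Ω] (μ : Measure Ω) [IsProbabilityMeasure μ]
    -- the disorder: i.i.d., square integrable, centred and not almost surely constant
    (ω : PinnedField.Site d → Ω → ℝ)
    (hmeas : ∀ x, Measurable (ω x))
    (hindep : iIndepFun ω μ)
    (hident : ∀ x, IdentDistrib (ω x) (ω 0) μ μ)
    (hL2 : MemLp (ω 0) 2 μ)
    (hmean : ∫ a, ω 0 a ∂μ = 0)
    (hvar : 0 < variance (ω 0) μ)
    -- finiteness of `λ(2b)` and `λ(-b)` for `b ∈ (0, βbar)`, where `βbar ∈ (0, ∞]`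
    (βbar : EReal) (hβbar : 0 < βbar)
    (hexp : ∀ b : ℝ, 0 < b → (b : EReal) < βbar →
      Integrable (fun a => Real.exp (2 * b * ω 0 a)) μ ∧
      Integrable (fun a => Real.exp (-b * ω 0 a)) μ)
    (β : ℝ) (hβ : 0 < β) (hββ : (β : EReal) < βbar) :
    ∀ ε : ℝ, 0 < ε → ∃ h₀ : ℝ, 0 < h₀ ∧ ∀ h : ℝ, 0 < h → h < h₀ →
      Tendsto
        (fun N : ℕ => ∫⁻ a,
          PinnedField.pinned d N (fun _ => 0) β (cgf (ω 0) μ β) h (fun x => ω x a)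
            {φ | ε * (N : ℝ) ^ d ≤
              (PinnedField.lowCount d N (Real.sqrt (1 / (4 * (d : ℝ)) * Real.log (1 / h)))
                (PinnedField.glue (PinnedField.box d N) (fun _ => 0) φ) : ℝ)} ∂μ)
        atTop (𝓝 0) := by
  intro ε hε
  have hd0 : NeZero d := ⟨by omega⟩
  have hdpos : (0 : ℝ) < d := by exact_mod_cast NeZero.pos d
  set l := cgf (ω 0) μ β
  -- the one-site density of the tilted disorder
  have hint : Integrable (fun a => Real.exp (β * ω 0 a)) μ := by
    have h2 := (hexp β hβ hββ).1
    have hm0 := hmeas 0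
    refine ((integrable_const 1).add h2).mono' (by fun_prop) (ae_of_all _ fun a => ?_)
    rw [Real.norm_eq_abs, abs_of_pos (Real.exp_pos _), Pi.add_apply]
    rcases le_total 0 (ω 0 a) with h0 | h0
    · have : Real.exp (β * ω 0 a) ≤ Real.exp (2 * β * ω 0 a) :=
        Real.exp_le_exp.2 (by nlinarith)
      linarith
    · have : Real.exp (β * ω 0 a) ≤ 1 := Real.exp_le_one_iff.2 (by nlinarith)
      have := Real.exp_pos (2 * β * ω 0 a)
      linarith
  have hY : Integrable (fun a => Real.exp (β * ω 0 a - l)) μ := by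
    simp only [sub_eq_add_neg, Real.exp_add]
    exact hint.mul_const _
  have hY1 : ∫ a, Real.exp (β * ω 0 a - l) ∂μ = 1 := by
    simp only [Real.exp_sub]
    rw [integral_div]
    have : Real.exp l = ∫ a, Real.exp (β * ω 0 a) ∂μ := exp_cgf hint
    rw [← this, div_self (Real.exp_pos l).ne']
  have hne : ¬ (fun a => Real.exp (β * ω 0 a - l)) =ᵐ[μ] fun _ => 1 := by
    intro h1
    have h2 : ω 0 =ᵐ[μ] fun _ => l / β := by
      filter_upwards [h1] with a ha
      rw [Real.exp_eq_one_iff] at ha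
      field_simp
      linarith
    rw [variance_congr h2, ← covariance_self aemeasurable_const, covariance_const_left] at hvar
    exact lt_irrefl _ hvar
  obtain ⟨C, hC, u₀, hu₀, hsqrt⟩ :=
    exists_integral_sqrt_le (fun a => (Real.exp_pos _).le) hY hY1 hne
  obtain ⟨c, hc, h₁, hh₁, hlow⟩ := exists_lowWeight_bound hdpos hε
  set ν := μ.map (ω 0)
  have hν : IsProbabilityMeasure ν := Measure.isProbabilityMeasure_map (hmeas 0).aemeasurable
  have hone : ∫⁻ t, ENNReal.ofReal (Real.exp (β * t - l)) ∂ν ≤ 1 := by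
    rw [lintegral_map (by fun_prop) (hmeas 0), ← ofReal_integral_eq_lintegral_ofReal hY
      (ae_of_all _ fun _ => (Real.exp_pos _).le), hY1, ENNReal.ofReal_one]
  -- Below `b^3`, `y = h^(1/3)` satisfies `256 C y ≤ c ε`. With `h ≤ y^2` this makes the contact
  -- threshold, of order `C h`, negligible against `θ ε`, of order `h^(1/3)`.
  set b := min 1 (c * ε / (256 * C))
  have hb : 0 < b := lt_min one_pos (by positivity)
  refine ⟨min (min h₁ (u₀ / 2)) (min 1 (b ^ 3)), by positivity, fun h hh hh0 => ?_⟩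
  simp only [lt_min_iff] at hh0
  obtain ⟨⟨hhh₁, hhu⟩, hh1, hhb⟩ := hh0
  set y := Real.exp (Real.log h / 3)
  have hy : 0 < y := Real.exp_pos _
  have hy3 : y ^ 3 = h := by
    rw [← Real.exp_nat_mul]
    have : ((3 : ℕ) : ℝ) * (Real.log h / 3) = Real.log h := by push_cast; ring
    rw [this, Real.exp_log hh]
  have hyb : y < b := lt_of_pow_lt_pow_left₀ 3 hb.le (by rw [hy3]; exact hhb)
  have hy1 : y < 1 := hyb.trans_le (min_le_left _ _)
  have hyc : 256 * C * y ≤ c * ε := by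
    have := hyb.le.trans (min_le_right _ _)
    rw [le_div_iff₀ (by positivity)] at this
    linarith
  set θ := c * y
  have hθ : 0 < θ := mul_pos hc hy
  set r := √(1 / (4 * (d : ℝ)) * Real.log (1 / h))
  -- The no-contact cost must be small against the gain in both regimes, hence the two terms.
  set ρ := min (θ * ε / 16) (4 * C * h ^ 2)
  have hρ : 0 < ρ := by positivity
  have hρ1 : ρ ≤ θ * ε / 16 := min_le_left _ _
  have hρ2 : ρ ≤ 4 * C * h ^ 2 := min_le_right _ _
  have hsmall : 32 * C * h ≤ θ * ε / 8 := by
    have h1 : h ≤ y * y := by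
      rw [← hy3]
      nlinarith
    have h2 : 256 * C * y * y ≤ c * ε * y := mul_le_mul_of_nonneg_right hyc hy.le
    simp only [θ]
    nlinarith
  have hbound : ∀ᶠ N : ℕ in atTop, ∫⁻ a, pinned d N (fun _ => 0) β l h (fun x => ω x a)
      {φ | ε * (N : ℝ) ^ d ≤ (lowCount d N r (glue (box d N) (fun _ => 0) φ) : ℝ)} ∂μ ≤
        2 * ENNReal.ofReal (Real.exp (-(ρ / 2 * (N : ℝ) ^ d))) := by
    filter_upwards [eventually_le_gaussMeasure_one_lt (d := d) hρ, eventually_ge_atTop 1,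
      eventually_ge_atTop ⌈d / (ε / 2)⌉₊] with N hNq hN1 hNd
    have hNd' : (d : ℝ) ≤ ε / 2 * N := by
      have := Nat.ceil_le.1 hNd
      rw [div_le_iff₀ (by positivity)] at this
      linarith
    -- Half of `ε` is given up to the boundary layer, where the field is zero and hence low.
    have hsub : {φ : interiorPts (box d N) → ℝ |
        ε * (N : ℝ) ^ d ≤ (lowCount d N r (glue (box d N) (fun _ => 0) φ) : ℝ)} ⊆
        {φ | ε / 2 * (N : ℝ) ^ d ≤ lowSum r φ} := by
      intro φ hφ
      simp only [Set.mem_ofPred_eq] at hφ ⊢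
      have h1 := lowCount_le r φ
      have h2 := pow_sub_pow_pred_le (d := d) hN1 hNd'
      linarith
    have hω : μ.map (fun a (x : interiorPts (box d N)) => ω x a) = Measure.pi fun _ => ν := by
      have h1 := (iIndepFun_iff_map_fun_eq_pi_map fun x : interiorPts (box d N) =>
        (hmeas x).aemeasurable).1 (hindep.precomp Subtype.val_injective)
      rw [h1]
      congr 1
      ext1 x
      exact (hident x).map_eq
    refine (lintegral_mono fun a => measure_mono hsub).trans ?_
    -- With this `m`, the gain `h m / 2 = 8 C h^2 N^d` beats the disorder cost `4 C h^2 N^d` plus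
    -- half the no-contact cost, at most `2 C h^2 N^d`.
    refine (lintegral_pinned_lowSum_le hmeas hω (C := C) (θ := θ) (v := θ * ε / 4)
      (m := 16 * C * h * (N : ℝ) ^ d) (Q := ρ * (N : ℝ) ^ d) hh.le hC.le hθ.le hone
      (fun p hp0 hp1 => ?_) (fun m => hlow h hh hhh₁ m) hNq).trans ?_
    · rw [lintegral_map (by fun_prop) (hmeas 0)]
      exact hsqrt (2 * h) (by positivity) (by linarith) p hp0 hp1
    have hNpos : (0 : ℝ) < (N : ℝ) ^ d := by
      have : (0 : ℝ) < N := by exact_mod_cast hN1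
      positivity
    have hpred : ((N - 1 : ℕ) : ℝ) ^ d ≤ (N : ℝ) ^ d := by
      gcongr
      exact Nat.sub_le _ _
    rw [two_mul (ENNReal.ofReal _)]
    refine add_le_add (ENNReal.ofReal_le_ofReal (Real.exp_le_exp.2 ?_))
      (ENNReal.ofReal_le_ofReal (Real.exp_le_exp.2 ?_))
    · have h1 : ((N - 1 : ℕ) : ℝ) ^ d * (θ * ε / 4) ≤ (N : ℝ) ^ d * (θ * ε / 4) := by gcongr
      -- In units of `θ ε`, the left side is at most `1/16 + 1/8 - 1/2 + 1/4 = -1/16`.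
      have h2 : ρ + h * (16 * C * h) + 16 * C * h - θ * (ε / 2) + θ * ε / 4 ≤ -(ρ / 2) := by
        have : h * (16 * C * h) ≤ 16 * C * h := by
          have : 0 < 16 * C * h := by positivity
          nlinarith
        linarith
      nlinarith [mul_le_mul_of_nonneg_right h2 hNpos.le]
    · have h1 : ((N - 1 : ℕ) : ℝ) ^ d * (C * (2 * h) ^ 2) ≤ (N : ℝ) ^ d * (C * (2 * h) ^ 2) := by
        gcongr
      nlinarith [mul_le_mul_of_nonneg_right hρ2 hNpos.le]
  have hlim : Tendsto (fun N : ℕ => 2 * ENNReal.ofReal (Real.exp (-(ρ / 2 * (N : ℝ) ^ d))))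
      atTop (𝓝 0) := by
    have h1 : Tendsto (fun N : ℕ => ρ / 2 * (N : ℝ) ^ d) atTop atTop :=
      ((tendsto_pow_atTop (NeZero.ne d)).comp tendsto_natCast_atTop_atTop).const_mul_atTop
        (by positivity)
    have h2 := ENNReal.tendsto_ofReal
      (Real.tendsto_exp_atBot.comp (tendsto_neg_atTop_atBot.comp h1))
    have h3 := ENNReal.Tendsto.const_mul h2 (Or.inr (ENNReal.ofNat_ne_top (n := 2)))
    simpa using h3
  exact tendsto_of_tendsto_of_tendsto_of_le_of_le' tendsto_const_nhds hlim
    (Eventually.of_forall fun _ => zero_le) hbound
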